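/- **Setting.** For $m\ge 4$ let $G^m=O(2,m-1)$ be the group of linear isometries of the form $-t_1^2-t_2^2+x_1^2+\dots+x_{m-1}^2$ on $\mathbb R^{m+1}$, with Lie algebra $\mathfrak g_m\subset M_{m+1}(\mathbb R)$. Write $E_{ab}$ for the matrix units with indices $0,\dots,m$ (so $t_1,t_2,x_k$ have the indices $0,1,k+1$), and put, for $1\le i,j\le m-3$, $$H=E_{03}+E_{30},\quad H_2=E_{12}+E_{21},\quad M_{ij}=E_{3+i,3+j}-E_{3+j,3+i},$$ $$Z_j^+=E_{1,3+j}+E_{2,3+j}+E_{3+j,1}-E_{3+j,2},\quad Z_j^-=(Z_j^+)^t,\quad Y_j^-=E_{3+j,0}+E_{3+j,3}+E_{0,3+j}-E_{3,3+j},$$ $$Q_1^-=E_{10}+E_{13}+E_{31}-E_{01},\quad Q_2^-=E_{20}+E_{23}+E_{02}-E_{32}.$$ Let $\mathfrak m_m=\mathrm{span}\{M_{ij},Z_j^\pm,H_2\}$, let $\mathfrak n_m^\pm$ be the $\pm1$-eigenspaces of $\mathrm{ad}(H)$, let $A=\exp(\mathbb RH)$, $N^+=\exp(\mathfrak n_m^+)$,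 and let $M_0$ be the analytic subgroup of $G^m$ with Lie algebra $\mathfrak m_m$. Let $K=O(2)\times O(m-1)$ and let $w_1,w_2\in K$ be the elements that change the sign of $t_2$, respectively of $x_1$. Put $J=-1\in G^m$, $M^m=Z_K(\mathbb RH)M_0$, $\hat M^m=\langle w_1,w_2\rangle M_0$, so that $M^m=\{1,J\}\hat M^m$, and $P^m=M^mAN^+$, $\hat P^m=\hat M^mAN^+$. Let $\sigma_-$ be the character of $M^m$ with $\sigma_-=1$ on $\hat M^m$ and $\sigma_-(J)=-1$. For $\lambda\in\mathbb C$ let $\xi_\lambda(\exp(tH))=e^{\lambda t}$. Let $i:G^n\to G^{n+1}$, $g\mapsto\mathrm{diag}(g,1)$. For a character $\sigma$ of $M^m$ and for $(k,m)=(m,m)$ or $(m+1,m)$, with $G^m\subset G^{m+1}$ through $i$, let $$\mathrm{Ind}_{P^m}^{G^k}(\xi_\lambda\otimes\sigma)=\{u\in C^\infty(G^k,\mathbb C): u(gman')=\sigma(m)\,\xi_\lambda(a)\,u(g)\text{ for } g\in G^k,\ m\in M^m,\ a\in A,\ n'\in N^+\},$$ with $G^k$ acting by left translation $(g\cdot u)(x)=u(g^{-1}x)$;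 $\mathrm{Ind}_{\hat P^m}^{G^k}(\xi_\lambda)$ is defined in the same way with $\hat M^m$ for $M^m$ and the trivial $\sigma$, and we omit the trivial $\sigma$ from the notation. The complex universal enveloping algebra $\mathcal U(\mathfrak g_k)$ acts on $C^\infty(G^k)$ by left-invariant differential operators, through the extension of $(R(X)u)(x)=\frac{d}{dt}\big|_{t=0}u(x\exp(tX))$, $X\in\mathfrak g_k$. For $n\ge4$ let, in $\mathcal U(\mathfrak n_{n+1}^-)$, $T_n=Y_{n-2}^-$ and $\Delta_{n-1}=-(Q_1^-)^2+(Q_2^-)^2+\sum_{j=1}^{n-3}(Y_j^-)^2$, and let $$\mathcal D^0_{2k}(\lambda)=\sum_{j=0}^k a_j(\lambda)\,\Delta_{n-1}^j\,T_n^{2k-2j},\qquad \mathcal D^0_{2k+1}(\lambda)=\sum_{j=0}^k b_j(\lambda)\,\Delta_{n-1}^j\,T_n^{2k+1-2j},$$ where $a_j,b_j\in\mathbb C[\lambda]$ are determined by $a_k=b_k=1$ and, for $1\le j\le k$, $$(k-j+1)(2k-2j+1)\,a_{j-1}(\lambda)+j(n-1+2\lambda-4k+2j)\,a_j(\lambda)=0,$$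 $$(k-j+1)(2k-2j+3)\,b_{j-1}(\lambda)+j(n-3+2\lambda-4k+2j)\,b_j(\lambda)=0.$$ **Theorem 1.2.** Let $n\ge4$ and let $N\ge0$ be an integer. Let $\sigma$ be the trivial character of $M^n$ if $N$ is even, and $\sigma=\sigma_-$ if $N$ is odd. (a) For every $\lambda\in\mathbb C$ the operator $R(\mathcal D^0_N(\lambda))$ restricts to a linear $G^{n+1}$-equivariant map $$D'_N(\lambda):\mathrm{Ind}_{P^{n+1}}^{G^{n+1}}(\xi_\lambda)\to\mathrm{Ind}_{P^n}^{G^{n+1}}(\xi_{\lambda-N}\otimes\sigma),$$ and its composition with the restriction $i^*:C^\infty(G^{n+1})\to C^\infty(G^n)$ is a linear $G^n$-equivariant map $$D_N(\lambda)=i^*\circ D'_N(\lambda):\mathrm{Ind}_{P^{n+1}}^{G^{n+1}}(\xi_\lambda)\to\mathrm{Ind}_{P^n}^{G^n}(\xi_{\lambda-N}\otimes\sigma).$$ (b) For every $\lambda\in\mathbb C$ the operator $R(\mathcal D^0_N(\lambda))$ restricts to a linear $G^{n+1}$-equivariant map $$\hat D'_N(\lambda):\mathrm{Ind}_{\hat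 P^{n+1}}^{G^{n+1}}(\xi_\lambda)\to\mathrm{Ind}_{\hat P^n}^{G^{n+1}}(\xi_{\lambda-N}),$$ and its composition with $i^*$ is a linear $G^n$-equivariant map $$\hat D_N(\lambda)=i^*\circ\hat D'_N(\lambda):\mathrm{Ind}_{\hat P^{n+1}}^{G^{n+1}}(\xi_\lambda)\to\mathrm{Ind}_{\hat P^n}^{G^n}(\xi_{\lambda-N}).$$ -/

import Mathlib

open scoped Matrix TensorProduct Topology ContDiff

noncomputable section

namespace AdSEin

attribute [local instance 100] LieRing.ofAssociativeRing

/-! ### The group `O(2, m-1)` and its Lie algebra -/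

/-- Real matrices of size `m + 1`; the coordinates of `ℝ^(m+1)` are `(t₁, t₂, x₁, …, x_(m-1))`,
so that `t₁, t₂` have the indices `0, 1` and `x_k` has the index `k + 1`. -/
abbrev Mat (m : ℕ) : Type := Matrix (Fin (m + 1)) (Fin (m + 1)) ℝ

/-- The Gram matrix of `-t₁² - t₂² + x₁² + ⋯ + x_(m-1)²`. -/
def eta (m : ℕ) : Mat m := Matrix.diagonal fun i => if i.val < 2 then -1 else 1

theorem eta_mul_eta (m : ℕ) : eta m * eta m = 1 := by
  rw [eta, Matrix.diagonal_mul_diagonal, ← Matrix.diagonal_one]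
  congr 1
  funext i
  split_ifs <;> norm_num

theorem eta_transpose (m : ℕ) : (eta m)ᵀ = eta m := Matrix.diagonal_transpose _

/-- The group `G^m = O(2, m-1)`. -/
def G (m : ℕ) : Subgroup (GL (Fin (m + 1)) ℝ) where
  carrier := {g | (g : Mat m)ᵀ * eta m * (g : Mat m) = eta m}
  mul_mem' := by
    intro a b ha hb
    simp only [Set.mem_ofPred_eq, Units.val_mul, Matrix.transpose_mul] at ha hb ⊢
    calc (b : Mat m)ᵀ * (a : Mat m)ᵀ * eta m * ((a : Mat m) * (b : Mat m))
        = (b : Mat m)ᵀ * ((a : Mat m)ᵀ * eta m * (a : Mat m)) * (b : Mat m) := by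
          simp only [mul_assoc]
      _ = eta m := by rw [ha, hb]
  one_mem' := by simp
  inv_mem' := by
    intro a ha
    simp only [Set.mem_ofPred_eq] at ha ⊢
    have h1 : (a : Mat m) * ((a⁻¹ : GL (Fin (m + 1)) ℝ) : Mat m) = 1 := a.mul_inv
    have h2 : (((a⁻¹ : GL (Fin (m + 1)) ℝ) : Mat m))ᵀ * (a : Mat m)ᵀ = 1 := by
      rw [← Matrix.transpose_mul, h1, Matrix.transpose_one]
    calc (((a⁻¹ : GL (Fin (m + 1)) ℝ) : Mat m))ᵀ * eta m * ((a⁻¹ : GL (Fin (m + 1)) ℝ) : Mat m)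
        = (((a⁻¹ : GL (Fin (m + 1)) ℝ) : Mat m))ᵀ * ((a : Mat m)ᵀ * eta m * (a : Mat m))
            * ((a⁻¹ : GL (Fin (m + 1)) ℝ) : Mat m) := by rw [ha]
      _ = ((((a⁻¹ : GL (Fin (m + 1)) ℝ) : Mat m))ᵀ * (a : Mat m)ᵀ) * eta m
            * ((a : Mat m) * ((a⁻¹ : GL (Fin (m + 1)) ℝ) : Mat m)) := by simp only [mul_assoc]
      _ = eta m := by rw [h1, h2, one_mul, mul_one]

/-- The underlying matrix of an element of `G^m`. -/
def toMat {m : ℕ} (g : G m) : Mat m := (g : GL (Fin (m + 1)) ℝ)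

theorem toMat_injective {m : ℕ} : Function.Injective (toMat (m := m)) := fun _ _ h =>
  Subtype.ext (Units.ext h)

theorem toMat_one {m : ℕ} : toMat (1 : G m) = 1 := rfl

theorem toMat_mul {m : ℕ} (g h : G m) : toMat (g * h) = toMat g * toMat h := rfl

theorem toMat_mem {m : ℕ} (g : G m) : (toMat g)ᵀ * eta m * toMat g = eta m := g.2

theorem continuous_toMat {m : ℕ} : Continuous (toMat (m := m)) :=
  Units.continuous_val.comp continuous_subtype_val

/-- The element of `G^m` given by a matrix that preserves the form. -/
def mkG {m : ℕ} (A : Mat m) (hA : Aᵀ * eta m * A = eta m) : G m :=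
  have hl : eta m * Aᵀ * eta m * A = 1 := by
    rw [mul_assoc (eta m), mul_assoc (eta m), hA, eta_mul_eta]
  ⟨⟨A, eta m * Aᵀ * eta m, mul_eq_one_comm.mp hl, hl⟩, hA⟩

theorem toMat_mkG {m : ℕ} (A : Mat m) (hA : Aᵀ * eta m * A = eta m) : toMat (mkG A hA) = A := rfl

/-- The Lie algebra `𝔤_m = 𝔬(2, m-1)`. -/
abbrev LieG (m : ℕ) : LieSubalgebra ℝ (Mat m) := skewAdjointMatricesLieSubalgebra (eta m)

theorem mem_LieG {m : ℕ} {X : Mat m} : X ∈ LieG m ↔ Xᵀ * eta m = eta m * -X := by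
  rw [mem_skewAdjointMatricesLieSubalgebra, mem_skewAdjointMatricesSubmodule]
  rfl

/-- The exponential map `𝔤_m → G^m`. -/
def expG {m : ℕ} (X : LieG m) : G m :=
  mkG (NormedSpace.exp (X : Mat m)) (by
    have hX : (X : Mat m)ᵀ = eta m * -(X : Mat m) * (eta m)⁻¹ := by
      have h := mem_LieG.1 X.2
      rw [← h, mul_assoc, Matrix.mul_nonsing_inv, mul_one]
      exact (Matrix.isUnit_iff_isUnit_det _).1 ⟨⟨_, _, eta_mul_eta m, eta_mul_eta m⟩, rfl⟩
    have hu : IsUnit (eta m) := ⟨⟨_, _, eta_mul_eta m, eta_mul_eta m⟩, rfl⟩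
    have hd : IsUnit (eta m).det := (Matrix.isUnit_iff_isUnit_det _).1 hu
    have hd2 : IsUnit (NormedSpace.exp (X : Mat m)).det :=
      (Matrix.isUnit_iff_isUnit_det _).1 (Matrix.isUnit_exp _)
    rw [← Matrix.exp_transpose, hX, Matrix.exp_conj _ _ hu, Matrix.exp_neg, mul_assoc,
      mul_assoc, Matrix.nonsing_inv_mul_cancel_left _ _ hd, mul_assoc,
      Matrix.nonsing_inv_mul _ hd2, mul_one])

theorem toMat_expG {m : ℕ} (X : LieG m) : toMat (expG X) = NormedSpace.exp (X : Mat m) := rfl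

/-! ### Elements of the Lie algebra -/

/-- The matrix unit with row index `a` and column index `b` (counted from `0`). -/
def E (m a b : ℕ) : Mat m := Matrix.of fun i j => if i.val = a ∧ j.val = b then 1 else 0

theorem E_transpose (m a b : ℕ) : (E m a b)ᵀ = E m b a := by
  ext i j
  simp [E, and_comm]

/-- The sign of the coordinate of index `a` in the form. -/
def sgn (a : ℕ) : ℝ := if a < 2 then -1 else 1

theorem eta_mul_E (m a b : ℕ) : eta m * E m a b = sgn a • E m a b := by
  ext i j
  rw [eta, Matrix.diagonal_mul]
  by_cases h : i.val = a <;> simp [E, sgn, h]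

theorem E_mul_eta (m a b : ℕ) : E m a b * eta m = sgn b • E m a b := by
  ext i j
  rw [eta, Matrix.mul_diagonal]
  by_cases h : j.val = b <;> by_cases h' : i.val = a <;> simp [E, sgn, h, h']

/-- `H`, which spans `𝔞`. -/
def H (m : ℕ) : LieG m := ⟨E m 0 3 + E m 3 0, by
  rw [mem_LieG]
  simp [E_transpose, add_mul, mul_add, E_mul_eta, eta_mul_E, sgn]⟩

/-- `H₂`. -/
def H2 (m : ℕ) : LieG m := ⟨E m 1 2 + E m 2 1, by
  rw [mem_LieG]
  simp [E_transpose, add_mul, mul_add, E_mul_eta, eta_mul_E, sgn]⟩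

/-- `M_{ij}`, for `1 ≤ i, j ≤ m - 3`. -/
def Mrot (m i j : ℕ) : LieG m := ⟨E m (3 + i) (3 + j) - E m (3 + j) (3 + i), by
  rw [mem_LieG]
  simp [E_transpose, sub_mul, mul_sub, E_mul_eta, eta_mul_E, sgn, show ¬ 3 + i < 2 by omega,
    show ¬ 3 + j < 2 by omega]⟩

/-- `Z_j^+`, for `1 ≤ j ≤ m - 3`. -/
def Zplus (m j : ℕ) : LieG m :=
  ⟨E m 1 (3 + j) + E m 2 (3 + j) + E m (3 + j) 1 - E m (3 + j) 2, by
  rw [mem_LieG]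
  simp [E_transpose, sub_mul, mul_sub, add_mul, mul_add, E_mul_eta, eta_mul_E, sgn,
    show ¬ 3 + j < 2 by omega]
  abel⟩

/-- `Z_j^- = (Z_j^+)ᵗ`, for `1 ≤ j ≤ m - 3`. -/
def Zminus (m j : ℕ) : LieG m :=
  ⟨E m (3 + j) 1 + E m (3 + j) 2 + E m 1 (3 + j) - E m 2 (3 + j), by
  rw [mem_LieG]
  simp [E_transpose, sub_mul, mul_sub, add_mul, mul_add, E_mul_eta, eta_mul_E, sgn,
    show ¬ 3 + j < 2 by omega]
  abel⟩

/-- `Y_j^-`, for `1 ≤ j ≤ m - 3`. -/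
def Yminus (m j : ℕ) : LieG m :=
  ⟨E m (3 + j) 0 + E m (3 + j) 3 + E m 0 (3 + j) - E m 3 (3 + j), by
  rw [mem_LieG]
  simp [E_transpose, sub_mul, mul_sub, add_mul, mul_add, E_mul_eta, eta_mul_E, sgn,
    show ¬ 3 + j < 2 by omega]
  abel⟩

/-- `Q_1^-`. -/
def Q1minus (m : ℕ) : LieG m := ⟨E m 1 0 + E m 1 3 + E m 3 1 - E m 0 1, by
  rw [mem_LieG]
  simp [E_transpose, sub_mul, mul_sub, add_mul, mul_add, E_mul_eta, eta_mul_E, sgn]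
  abel⟩

/-- `Q_2^-`. -/
def Q2minus (m : ℕ) : LieG m := ⟨E m 2 0 + E m 2 3 + E m 0 2 - E m 3 2, by
  rw [mem_LieG]
  simp [E_transpose, sub_mul, mul_sub, add_mul, mul_add, E_mul_eta, eta_mul_E, sgn]
  abel⟩

/-- `𝔪`, spanned by the `M_{ij}`, the root vectors `Z_j^±` of the roots `±f₂`, and `H₂`. -/
def mAlg (m : ℕ) : Submodule ℝ (LieG m) :=
  Submodule.span ℝ
    ({X | ∃ i j, 1 ≤ i ∧ i ≤ m - 3 ∧ 1 ≤ j ∧ j ≤ m - 3 ∧ X = Mrot m i j} ∪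
      {X | ∃ j, 1 ≤ j ∧ j ≤ m - 3 ∧ (X = Zplus m j ∨ X = Zminus m j)} ∪ {H2 m})

/-- `𝔫^+`, the eigenspace of `ad H` for the eigenvalue `1`. -/
def nPlus (m : ℕ) : Submodule ℝ (LieG m) where
  carrier := {X | ⁅H m, X⁆ = X}
  add_mem' := by
    intro X Y hX hY
    rw [Set.mem_ofPred_eq] at hX hY ⊢
    rw [lie_add, hX, hY]
  zero_mem' := lie_zero _
  smul_mem' := by
    intro c X hX
    rw [Set.mem_ofPred_eq] at hX ⊢
    rw [lie_smul, hX]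

/-- `𝔫^-`, the eigenspace of `ad H` for the eigenvalue `-1`. -/
def nMinus (m : ℕ) : Submodule ℝ (LieG m) where
  carrier := {X | ⁅H m, X⁆ = -X}
  add_mem' := by
    intro X Y hX hY
    rw [Set.mem_ofPred_eq] at hX hY ⊢
    rw [lie_add, hX, hY, neg_add]
  zero_mem' := by
    rw [Set.mem_ofPred_eq, lie_zero, neg_zero]
  smul_mem' := by
    intro c X hX
    rw [Set.mem_ofPred_eq] at hX ⊢
    rw [lie_smul, hX, smul_neg]

/-! ### The groups `M`, `M̂` and the character `σ_-` -/

/-- `M_0`, the analytic subgroup of `G^m` with Lie algebra `𝔪`: the subgroup generated by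
`exp 𝔪`. -/
def M0 (m : ℕ) : Subgroup (G m) := Subgroup.closure (expG '' (mAlg m : Set (LieG m)))

/-- The maximal compact subgroup `K = O(2) × O(m-1)` of `G^m`: its elements which are orthogonal
for the standard scalar product of `ℝ^(m+1)`. -/
def K (m : ℕ) : Subgroup (G m) where
  carrier := {k | (toMat k)ᵀ * toMat k = 1}
  mul_mem' := by
    intro a b ha hb
    simp only [Set.mem_ofPred_eq] at ha hb ⊢
    rw [toMat_mul, Matrix.transpose_mul, mul_assoc, ← mul_assoc (toMat a)ᵀ, ha, one_mul, hb]
  one_mem' := by simp [toMat_one]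
  inv_mem' := by
    intro a ha
    simp only [Set.mem_ofPred_eq] at ha ⊢
    have h1 : toMat a * toMat a⁻¹ = 1 := by rw [← toMat_mul, mul_inv_cancel, toMat_one]
    have h2 : (toMat a⁻¹)ᵀ * (toMat a)ᵀ = 1 := by
      rw [← Matrix.transpose_mul, h1, Matrix.transpose_one]
    calc (toMat a⁻¹)ᵀ * toMat a⁻¹
        = (toMat a⁻¹)ᵀ * ((toMat a)ᵀ * toMat a) * toMat a⁻¹ := by rw [ha, mul_one]
      _ = ((toMat a⁻¹)ᵀ * (toMat a)ᵀ) * (toMat a * toMat a⁻¹) := by simp only [mul_assoc]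
      _ = 1 := by rw [h1, h2, one_mul]

/-- `Z_K(𝔞)`, the centralizer of `𝔞 = ℝ H` in `K`. -/
def ZKa (m : ℕ) : Subgroup (G m) where
  carrier := {k | k ∈ K m ∧ toMat k * (H m : Mat m) = (H m : Mat m) * toMat k}
  mul_mem' := by
    rintro a b ⟨ha, ha'⟩ ⟨hb, hb'⟩
    refine ⟨mul_mem ha hb, ?_⟩
    rw [toMat_mul, mul_assoc, hb', ← mul_assoc, ha', mul_assoc]
  one_mem' := ⟨one_mem _, by rw [toMat_one, one_mul, mul_one]⟩
  inv_mem' := by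
    rintro a ⟨ha, ha'⟩
    refine ⟨inv_mem ha, ?_⟩
    have h1 : toMat a * toMat a⁻¹ = 1 := by rw [← toMat_mul, mul_inv_cancel, toMat_one]
    have h2 : toMat a⁻¹ * toMat a = 1 := by rw [← toMat_mul, inv_mul_cancel, toMat_one]
    calc toMat a⁻¹ * (H m : Mat m)
        = toMat a⁻¹ * ((H m : Mat m) * toMat a) * toMat a⁻¹ := by
          rw [mul_assoc, mul_assoc, h1, mul_one]
      _ = (H m : Mat m) * toMat a⁻¹ := by rw [← ha', ← mul_assoc, h2, one_mul]

/-- `M = Z_K(𝔞) M_0`. -/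
def MGroup (m : ℕ) : Subgroup (G m) := ZKa m ⊔ M0 m

/-- The element of `G^m` which changes the sign of the coordinate of index `a`. -/
def signFlip (m a : ℕ) : G m :=
  mkG (Matrix.diagonal fun i => if i.val = a then -1 else 1) (by
    rw [Matrix.diagonal_transpose, eta, Matrix.diagonal_mul_diagonal,
      Matrix.diagonal_mul_diagonal]
    congr 1
    funext i
    split_ifs <;> norm_num)

/-- `w_1`. -/
def w1 (m : ℕ) : G m := signFlip m 1

/-- `w_2`. -/
def w2 (m : ℕ) : G m := signFlip m 2

/-- `J = -1`. -/
def J (m : ℕ) : G m := mkG (-1) (by simp)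

theorem J_mem_MGroup (m : ℕ) : J m ∈ MGroup m := by
  refine Subgroup.mem_sup_left ⟨?_, ?_⟩
  · change (toMat (J m))ᵀ * toMat (J m) = 1
    simp [J, toMat_mkG]
  · simp [J, toMat_mkG]

/-- `M̂ = ⟨w_1, w_2⟩ M_0`. -/
def MHat (m : ℕ) : Subgroup (G m) := Subgroup.closure {w1 m, w2 m} ⊔ M0 m

/-- The subgroup of all `g ∈ G^m` which preserve the line spanned by the first basis vector. -/
def stabFirst (m : ℕ) : Subgroup (G m) where
  carrier := {g | ∀ i : Fin (m + 1), i ≠ 0 → toMat g i 0 = 0 ∧ toMat g⁻¹ i 0 = 0}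
  mul_mem' := by
    intro a b ha hb i hi
    rw [mul_inv_rev, toMat_mul, toMat_mul, Matrix.mul_apply, Matrix.mul_apply]
    constructor
    · refine Finset.sum_eq_zero fun j _ => ?_
      by_cases hj : j = 0
      · rw [hj, (ha i hi).1, zero_mul]
      · rw [(hb j hj).1, mul_zero]
    · refine Finset.sum_eq_zero fun j _ => ?_
      by_cases hj : j = 0
      · rw [hj, (hb i hi).2, zero_mul]
      · rw [(ha j hj).2, mul_zero]
  one_mem' := by
    intro i hi
    rw [inv_one, toMat_one]
    exact ⟨Matrix.one_apply_ne hi, Matrix.one_apply_ne hi⟩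
  inv_mem' := by
    intro a ha i hi
    rw [inv_inv]
    exact ⟨(ha i hi).2, (ha i hi).1⟩

theorem mAlg_col {m : ℕ} {X : LieG m} (hX : X ∈ mAlg m) (i : Fin (m + 1)) :
    (X : Mat m) i 0 = 0 := by
  induction hX using Submodule.span_induction with
  | mem x h =>
    rcases h with (⟨a, b, -, -, -, -, rfl⟩ | ⟨a, -, -, rfl | rfl⟩) | rfl
    · simp [Mrot, E, show ∀ k, 0 ≠ 3 + k by omega]
    · simp [Zplus, E, show ∀ k, 0 ≠ 3 + k by omega]
    · simp [Zminus, E, show ∀ k, 0 ≠ 3 + k by omega]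
    · simp [H2, E]
  | zero => rfl
  | add x y _ _ hx hy => simp [hx, hy]
  | smul c x _ hx => simp [hx]

section

attribute [local instance] Matrix.linftyOpNormedRing Matrix.linftyOpNormedAlgebra

theorem exp_col {m : ℕ} {X : LieG m} (hX : X ∈ mAlg m) (i : Fin (m + 1)) :
    toMat (expG X) i 0 = (1 : Mat m) i 0 := by
  have h : SemiconjBy (Matrix.single 0 0 1 : Mat m) 0 (X : Mat m) := by
    ext j k
    rw [mul_zero, Matrix.mul_apply, Matrix.zero_apply]
    refine (Finset.sum_eq_zero fun l _ => ?_).symm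
    by_cases hl : l = 0
    · rw [hl, mAlg_col hX, zero_mul]
    · rw [Matrix.single_apply_of_row_ne (Ne.symm hl), mul_zero]
  have h2 := h.exp_right
  rw [SemiconjBy, NormedSpace.exp_zero, mul_one] at h2
  have h3 := congrFun (congrFun h2 i) 0
  rw [Matrix.mul_apply, Finset.sum_eq_single 0] at h3
  · simp only [Matrix.single_apply_same, mul_one] at h3
    refine h3.symm.trans ?_
    rw [Matrix.one_apply, Matrix.single_apply]
    simp [eq_comm]
  · intro l _ hl
    rw [Matrix.single_apply_of_row_ne (Ne.symm hl), mul_zero]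
  · simp

end

theorem expG_inv {m : ℕ} (X : LieG m) : (expG X)⁻¹ = expG (-X) := by
  refine inv_eq_of_mul_eq_one_right (toMat_injective ?_)
  rw [toMat_mul, toMat_expG, toMat_expG, NegMemClass.coe_neg, toMat_one, Matrix.exp_neg,
    Matrix.mul_nonsing_inv]
  exact (Matrix.isUnit_iff_isUnit_det _).1 (Matrix.isUnit_exp _)

theorem M0_le_stabFirst (m : ℕ) : M0 m ≤ stabFirst m := by
  rw [M0, Subgroup.closure_le]
  rintro _ ⟨X, hX, rfl⟩ i hi
  rw [expG_inv, exp_col hX, exp_col (neg_mem hX)]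
  exact ⟨Matrix.one_apply_ne hi, Matrix.one_apply_ne hi⟩

theorem ZKa_col {m : ℕ} (hm : 3 ≤ m) {k : G m} (hk : k ∈ ZKa m) (i : Fin (m + 1)) (hi : i ≠ 0) :
    toMat k i 0 = 0 := by
  obtain ⟨h1, h2⟩ := hk
  have h3 : eta m * toMat k = toMat k * eta m := by
    have h4 : toMat k * (toMat k)ᵀ = 1 := mul_eq_one_comm.mp h1
    have h5 := toMat_mem k
    calc eta m * toMat k = toMat k * ((toMat k)ᵀ * eta m * toMat k) := by
          rw [← mul_assoc, ← mul_assoc, h4, one_mul]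
      _ = toMat k * eta m := by rw [h5]
  by_cases hi3 : i.val = 3
  · have h6 := congrFun (congrFun h3 i) 0
    rw [eta, Matrix.diagonal_mul, Matrix.mul_diagonal] at h6
    simp [hi3] at h6
    linarith
  · have h7 := congrFun (congrFun h2 i) ⟨3, by omega⟩
    rw [Matrix.mul_apply, Matrix.mul_apply, Finset.sum_eq_single 0, Finset.sum_eq_zero] at h7
    · simpa [H, E] using h7
    · intro j _
      simp [H, E, hi3, hi]
    · intro j _ hj
      simp [H, E, hj]
    · simp

theorem MGroup_le_stabFirst {m : ℕ} (hm : 3 ≤ m) : MGroup m ≤ stabFirst m := by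
  refine sup_le (fun k hk i hi => ⟨ZKa_col hm hk i hi, ZKa_col hm (inv_mem hk) i hi⟩)
    (M0_le_stabFirst m)

/-- The representation `σ_-` of `M`. An element `x ∈ M` acts on the plane spanned by the basis
vectors of the coordinates `t₁, x₂` by a scalar, which is `1` for `x ∈ M̂` and `-1` for `x = J`;
the representation is this scalar. -/
def sigmaMinus {m : ℕ} (hm : 3 ≤ m) : MGroup m →* ℂ where
  toFun x := ((toMat x.1 0 0 : ℝ) : ℂ)
  map_one' := by simp [toMat_one]
  map_mul' x y := by
    rw [Subgroup.coe_mul, toMat_mul, Matrix.mul_apply, Finset.sum_eq_single 0]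
    · push_cast
      rfl
    · intro j _ hj
      rw [(MGroup_le_stabFirst hm y.2 j hj).1, mul_zero]
    · simp

theorem sigmaMinus_J {m : ℕ} (hm : 3 ≤ m) : sigmaMinus hm ⟨J m, J_mem_MGroup m⟩ = -1 := by
  simp [sigmaMinus, J, toMat_mkG]

theorem sigmaMinus_of_mem_MHat {m : ℕ} (hm : 3 ≤ m) (x : MGroup m) (hx : x.1 ∈ MHat m) :
    sigmaMinus hm x = 1 := by
  suffices h : ∀ y ∈ MHat m, y ∈ stabFirst m ∧ toMat y 0 0 = 1 by
    change ((toMat x.1 0 0 : ℝ) : ℂ) = 1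
    rw [(h _ hx).2, Complex.ofReal_one]
  have key : ∀ x y : G m, y ∈ stabFirst m → toMat (x * y) 0 0 = toMat x 0 0 * toMat y 0 0 := by
    intro x y hy
    rw [toMat_mul, Matrix.mul_apply, Finset.sum_eq_single 0]
    · intro j _ hj
      rw [(hy j hj).1, mul_zero]
    · simp
  let S : Subgroup (G m) :=
    { carrier := {y | y ∈ stabFirst m ∧ toMat y 0 0 = 1}
      mul_mem' := by
        rintro a b ⟨ha, ha'⟩ ⟨hb, hb'⟩
        exact ⟨mul_mem ha hb, by rw [key _ _ hb, ha', hb', one_mul]⟩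
      one_mem' := ⟨one_mem _, by simp [toMat_one]⟩
      inv_mem' := by
        rintro a ⟨ha, ha'⟩
        refine ⟨inv_mem ha, ?_⟩
        have h := key a⁻¹ a ha
        rw [inv_mul_cancel, ha', mul_one] at h
        rw [← h, toMat_one, Matrix.one_apply_eq] }
  have hflip : ∀ a : ℕ, a ≠ 0 → signFlip m a ∈ S := by
    intro a ha
    have hinv : (signFlip m a)⁻¹ = signFlip m a := by
      refine inv_eq_of_mul_eq_one_right (toMat_injective ?_)
      rw [toMat_mul, signFlip, toMat_mkG, toMat_one, Matrix.diagonal_mul_diagonal,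
        ← Matrix.diagonal_one]
      congr 1
      funext i
      split_ifs <;> norm_num
    refine ⟨fun i hi => ?_, ?_⟩
    · rw [hinv]
      simp [signFlip, toMat_mkG, Matrix.diagonal_apply_ne _ hi]
    · simp [signFlip, toMat_mkG, ha.symm]
  have hle : MHat m ≤ S := by
    refine sup_le ?_ ?_
    · rw [Subgroup.closure_le]
      rintro _ (rfl | rfl)
      · exact hflip 1 one_ne_zero
      · exact hflip 2 two_ne_zero
    · rw [M0, Subgroup.closure_le]
      rintro _ ⟨X, hX, rfl⟩
      refine ⟨M0_le_stabFirst m (Subgroup.subset_closure ⟨X, hX, rfl⟩), ?_⟩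
      rw [exp_col hX, Matrix.one_apply_eq]
  exact fun y hy => hle hy

/-! ### Smooth functions on `G^m` and left-invariant differential operators -/

/-- The space of matrix entries, a plain finite-dimensional coordinate space. -/
abbrev Entries (m : ℕ) : Type := Fin (m + 1) → Fin (m + 1) → ℝ

/-- The matrix entries of an element of `G^m`. -/
def entries {m : ℕ} (g : G m) : Entries m := fun i j => toMat g i j

/-- Smooth functions on the closed submanifold `G^m` of the space of matrices: the functions
which are locally restrictions of smooth functions of the matrix entries. -/
def IsSmooth {m : ℕ} (f : G m → ℂ) : Prop :=
  ∀ g : G m, ∃ F : Entries m → ℂ, ContDiff ℝ ∞ F ∧ ∀ᶠ h : G m in 𝓝 g, f h = F (entries h)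

/-- `C^∞(G^m)`. -/
def Smooth (m : ℕ) : Submodule ℂ (G m → ℂ) where
  carrier := {f | IsSmooth f}
  add_mem' := by
    intro a b ha hb g
    obtain ⟨A, hA, hA'⟩ := ha g
    obtain ⟨B, hB, hB'⟩ := hb g
    refine ⟨fun x => A x + B x, hA.add hB, ?_⟩
    filter_upwards [hA', hB'] with x h1 h2
    rw [Pi.add_apply, h1, h2]
  zero_mem' := fun g => ⟨fun _ => 0, contDiff_const, Filter.Eventually.of_forall fun _ => rfl⟩
  smul_mem' := by
    intro c a ha g
    obtain ⟨A, hA, hA'⟩ := ha g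
    refine ⟨fun x => c * A x, contDiff_const.mul hA, ?_⟩
    filter_upwards [hA'] with x h1
    rw [Pi.smul_apply, h1, smul_eq_mul]

/-- `(R(X) f)(x) = d/dt f(x exp(tX))` at `t = 0`. -/
def rightDeriv {m : ℕ} (X : LieG m) (f : G m → ℂ) (x : G m) : ℂ :=
  deriv (fun t : ℝ => f (x * expG (t • X))) 0

theorem expG_zero {m : ℕ} : expG (0 : LieG m) = 1 :=
  toMat_injective (by rw [toMat_expG, ZeroMemClass.coe_zero, NormedSpace.exp_zero, toMat_one])

/-- Multiplication with a fixed matrix from the right, on the space of matrix entries. -/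
def mulRight {m : ℕ} (X : Mat m) : Entries m →L[ℝ] Entries m :=
  LinearMap.toContinuousLinearMap
    { toFun := fun A i j => ∑ k, A i k * X k j
      map_add' := fun A B => by
        funext i j
        simp [add_mul, Finset.sum_add_distrib]
      map_smul' := fun c A => by
        funext i j
        simp [Finset.mul_sum, mul_assoc] }

theorem mulRight_apply {m : ℕ} (X : Mat m) (A : Entries m) (i j : Fin (m + 1)) :
    mulRight X A i j = ∑ k, A i k * X k j := rfl

theorem mulRight_add {m : ℕ} (X Y : Mat m) (A : Entries m) :
    mulRight (X + Y) A = mulRight X A + mulRight Y A := by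
  funext i j
  simp [mulRight_apply, mul_add, Finset.sum_add_distrib]

theorem mulRight_smul {m : ℕ} (c : ℝ) (X : Mat m) (A : Entries m) :
    mulRight (c • X) A = c • mulRight X A := by
  funext i j
  simp [mulRight_apply, Finset.mul_sum, mul_left_comm]

theorem mulRight_lie {m : ℕ} (X Y : Mat m) (A : Entries m) :
    mulRight ⁅X, Y⁆ A = mulRight Y (mulRight X A) - mulRight X (mulRight Y A) := by
  funext i j
  have h : ∀ P Q : Mat m, mulRight Q (mulRight P A) i j = (Matrix.of A * (P * Q)) i j := by
    intro P Q
    rw [← mul_assoc]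
    rfl
  rw [Pi.sub_apply, Pi.sub_apply, h, h, ← Matrix.sub_apply, ← mul_sub]
  rfl

section

attribute [local instance] Matrix.linftyOpNormedRing Matrix.linftyOpNormedAlgebra

theorem continuous_expG_smul {m : ℕ} (X : LieG m) : Continuous fun t : ℝ => expG (t • X) := by
  have h1 : Continuous fun t : ℝ => NormedSpace.exp (t • (X : Mat m)) :=
    NormedSpace.exp_continuous.comp (continuous_id.smul continuous_const)
  refine Continuous.subtype_mk (Units.continuous_iff.2 ⟨h1, ?_⟩) _
  change Continuous fun t : ℝ => eta m * (NormedSpace.exp (t • (X : Mat m)))ᵀ * eta m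
  exact (continuous_const.mul h1.matrix_transpose).mul continuous_const

theorem hasDerivAt_curve {m : ℕ} (g : G m) (X : LieG m) :
    HasDerivAt (fun t : ℝ => entries (g * expG (t • X))) (mulRight (X : Mat m) (entries g)) 0 := by
  have h := (hasDerivAt_exp_smul_const (𝕂 := ℝ) (X : Mat m) 0).const_mul (toMat g)
  rw [zero_smul, NormedSpace.exp_zero, one_mul] at h
  refine hasDerivAt_pi.2 fun i => hasDerivAt_pi.2 fun j => ?_
  exact (LinearMap.toContinuousLinearMap
    (Matrix.entryLinearMap ℝ ℝ i j)).hasFDerivAt.comp_hasDerivAt 0 h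

end

theorem rightDeriv_eq {m : ℕ} {f : G m → ℂ} {F : Entries m → ℂ} {g : G m} (hF : ContDiff ℝ ∞ F)
    (h : ∀ᶠ x : G m in 𝓝 g, f x = F (entries x)) (X : LieG m) :
    rightDeriv X f g = fderiv ℝ F (entries g) (mulRight (X : Mat m) (entries g)) := by
  have hc : Continuous fun t : ℝ => g * expG (t • X) :=
    continuous_const.mul (continuous_expG_smul X)
  have h0 : g * expG ((0 : ℝ) • X) = g := by rw [zero_smul, expG_zero, mul_one]
  have ht : Filter.Tendsto (fun t : ℝ => g * expG (t • X)) (𝓝 0) (𝓝 g) := by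
    have := hc.tendsto 0
    rwa [h0] at this
  have h1 : (fun t : ℝ => f (g * expG (t • X))) =ᶠ[𝓝 0]
      fun t : ℝ => F (entries (g * expG (t • X))) := ht.eventually h
  rw [rightDeriv, h1.deriv_eq]
  have h2 : HasFDerivAt F (fderiv ℝ F (entries g)) (toMat (g * expG ((0 : ℝ) • X))) := by
    rw [h0]
    exact (hF.differentiable (by simp) _).hasFDerivAt
  exact (h2.comp_hasDerivAt 0 (hasDerivAt_curve g X)).deriv

theorem contDiff_deriv {m : ℕ} {F : Entries m → ℂ} (hF : ContDiff ℝ ∞ F) (X : Mat m) :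
    ContDiff ℝ ∞ fun A : Entries m => fderiv ℝ F A (mulRight X A) :=
  (hF.fderiv_right (m := ∞) le_rfl).clm_apply (mulRight X).contDiff

theorem rightDeriv_eventually {m : ℕ} {f : G m → ℂ} {F : Entries m → ℂ} {g : G m}
    (hF : ContDiff ℝ ∞ F) (h : ∀ᶠ x : G m in 𝓝 g, f x = F (entries x)) (X : LieG m) :
    ∀ᶠ x : G m in 𝓝 g,
      rightDeriv X f x = fderiv ℝ F (entries x) (mulRight (X : Mat m) (entries x)) := by
  filter_upwards [eventually_eventually_nhds.2 h] with x hx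
  exact rightDeriv_eq hF hx X

theorem IsSmooth.rightDeriv {m : ℕ} {f : G m → ℂ} (hf : IsSmooth f) (X : LieG m) :
    IsSmooth (rightDeriv X f) := by
  intro g
  obtain ⟨F, hF, h⟩ := hf g
  exact ⟨_, contDiff_deriv hF X, rightDeriv_eventually hF h X⟩

/-- The operator `R(X)` on `C^∞(G^m)`. -/
def rightOp {m : ℕ} (X : LieG m) : Module.End ℂ (Smooth m) where
  toFun u := ⟨rightDeriv X u.1, IsSmooth.rightDeriv u.2 X⟩
  map_add' u v := by
    refine Subtype.ext (funext fun g => ?_)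
    obtain ⟨A, hA, hA'⟩ := u.2 g
    obtain ⟨B, hB, hB'⟩ := v.2 g
    have hAB : ∀ᶠ x : G m in 𝓝 g, (u + v).1 x = (A + B) (entries x) := by
      filter_upwards [hA', hB'] with x h1 h2
      rw [Submodule.coe_add, Pi.add_apply, Pi.add_apply, h1, h2]
    change AdSEin.rightDeriv X (u + v).1 g
      = AdSEin.rightDeriv X u.1 g + AdSEin.rightDeriv X v.1 g
    rw [rightDeriv_eq (hA.add hB) hAB, rightDeriv_eq hA hA', rightDeriv_eq hB hB',
      fderiv_fun_add (hA.differentiable (by simp) _) (hB.differentiable (by simp) _)]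
    rfl
  map_smul' c u := by
    refine Subtype.ext (funext fun g => ?_)
    obtain ⟨A, hA, hA'⟩ := u.2 g
    have hcA : ∀ᶠ x : G m in 𝓝 g, (c • u).1 x = (c • A) (entries x) := by
      filter_upwards [hA'] with x h1
      rw [Submodule.coe_smul, Pi.smul_apply, Pi.smul_apply, h1]
    change AdSEin.rightDeriv X (c • u).1 g = c • AdSEin.rightDeriv X u.1 g
    rw [rightDeriv_eq (hA.const_smul c) hcA, rightDeriv_eq hA hA',
      fderiv_fun_const_smul (hA.differentiable (by simp) _)]
    rfl

/-- The differential `R : 𝔤_m → End C^∞(G^m)` of the right regular representation. -/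
def rightRep (m : ℕ) : LieG m →ₗ⁅ℝ⁆ Module.End ℂ (Smooth m) where
  toFun := rightOp
  map_add' X Y := by
    refine LinearMap.ext fun u => Subtype.ext (funext fun g => ?_)
    obtain ⟨A, hA, hA'⟩ := u.2 g
    change AdSEin.rightDeriv (X + Y) u.1 g
      = AdSEin.rightDeriv X u.1 g + AdSEin.rightDeriv Y u.1 g
    rw [rightDeriv_eq hA hA', rightDeriv_eq hA hA', rightDeriv_eq hA hA', ← map_add, ← mulRight_add]
    rfl
  map_smul' c X := by
    refine LinearMap.ext fun u => Subtype.ext (funext fun g => ?_)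
    obtain ⟨A, hA, hA'⟩ := u.2 g
    change AdSEin.rightDeriv (c • X) u.1 g = c • AdSEin.rightDeriv X u.1 g
    rw [rightDeriv_eq hA hA', rightDeriv_eq hA hA', ← map_smul, ← mulRight_smul]
    rfl
  map_lie' := by
    intro X Y
    refine LinearMap.ext fun u => Subtype.ext (funext fun g => ?_)
    obtain ⟨A, hA, hA'⟩ := u.2 g
    change AdSEin.rightDeriv ⁅X, Y⁆ u.1 g
      = AdSEin.rightDeriv X (AdSEin.rightDeriv Y u.1) g
        - AdSEin.rightDeriv Y (AdSEin.rightDeriv X u.1) g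
    have hd : Differentiable ℝ (fderiv ℝ A) :=
      (hA.fderiv_right (m := ∞) le_rfl).differentiable (by simp)
    have hXY : ∀ P Q : LieG m,
        fderiv ℝ (fun B : Entries m => fderiv ℝ A B (mulRight (Q : Mat m) B)) (entries g)
            (mulRight (P : Mat m) (entries g))
          = fderiv ℝ (fderiv ℝ A) (entries g) (mulRight (P : Mat m) (entries g))
              (mulRight (Q : Mat m) (entries g))
            + fderiv ℝ A (entries g) (mulRight (Q : Mat m) (mulRight (P : Mat m) (entries g))) := by
      intro P Q
      rw [((hd (entries g)).hasFDerivAt.clm_apply (mulRight (Q : Mat m)).hasFDerivAt).fderiv]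
      simp [add_comm]
    have hs : IsSymmSndFDerivAt ℝ A (entries g) :=
      hA.contDiffAt.isSymmSndFDerivAt (by
        rw [minSmoothness_of_isRCLikeNormedField]
        exact WithTop.coe_le_coe.2 (le_top : (2 : ℕ∞) ≤ ⊤))
    rw [rightDeriv_eq hA hA', rightDeriv_eq (contDiff_deriv hA _) (rightDeriv_eventually hA hA' Y),
      rightDeriv_eq (contDiff_deriv hA _) (rightDeriv_eventually hA hA' X), hXY, hXY,
      hs.eq (mulRight (X : Mat m) (entries g)) (mulRight (Y : Mat m) (entries g)),
      LieSubalgebra.coe_bracket, mulRight_lie, map_sub]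
    ring

/-- The complexified Lie algebra `𝔤_m ⊗ ℂ`. -/
abbrev LieGC (m : ℕ) : Type := ℂ ⊗[ℝ] LieG m

/-- The complex linear extension of a homomorphism of a real Lie algebra into a complex
associative algebra. -/
def extendHom {L A : Type*} [LieRing L] [LieAlgebra ℝ L] [Ring A] [Algebra ℝ A] [Algebra ℂ A]
    [IsScalarTower ℝ ℂ A] (f : L →ₗ⁅ℝ⁆ A) : ℂ ⊗[ℝ] L →ₗ⁅ℂ⁆ A where
  toLinearMap := LinearMap.liftBaseChange ℂ (f : L →ₗ[ℝ] A)
  map_lie' := by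
    intro x y
    change LinearMap.liftBaseChange ℂ (f : L →ₗ[ℝ] A) ⁅x, y⁆
      = ⁅LinearMap.liftBaseChange ℂ (f : L →ₗ[ℝ] A) x, LinearMap.liftBaseChange ℂ (f : L →ₗ[ℝ] A) y⁆
    induction x using TensorProduct.induction_on with
    | zero => rw [zero_lie, map_zero, zero_lie]
    | add x₁ x₂ h₁ h₂ => rw [add_lie, map_add, map_add, add_lie, h₁, h₂]
    | tmul a X =>
      induction y using TensorProduct.induction_on with
      | zero =>
        rw [show ⁅a ⊗ₜ[ℝ] X, (0 : ℂ ⊗[ℝ] L)⁆ = 0 from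
          lie_zero (L := ℂ ⊗[ℝ] L) (M := ℂ ⊗[ℝ] L) _, map_zero, lie_zero]
      | add y₁ y₂ h₁ h₂ =>
        rw [show ⁅a ⊗ₜ[ℝ] X, y₁ + y₂⁆ = ⁅a ⊗ₜ[ℝ] X, y₁⁆ + ⁅a ⊗ₜ[ℝ] X, y₂⁆ from
          lie_add (L := ℂ ⊗[ℝ] L) (M := ℂ ⊗[ℝ] L) _ _ _,
          map_add, map_add, lie_add, h₁, h₂]
      | tmul b Y =>
        rw [LieAlgebra.ExtendScalars.bracket_tmul, LinearMap.liftBaseChange_tmul,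
          LinearMap.liftBaseChange_tmul, LinearMap.liftBaseChange_tmul]
        change (a * b) • f ⁅X, Y⁆ = ⁅a • f X, b • f Y⁆
        rw [LieHom.map_lie, LieRing.of_associative_ring_bracket,
          LieRing.of_associative_ring_bracket, smul_mul_smul_comm, smul_mul_smul_comm,
          mul_comm b a, smul_sub]

theorem extendHom_tmul {L A : Type*} [LieRing L] [LieAlgebra ℝ L] [Ring A] [Algebra ℝ A]
    [Algebra ℂ A] [IsScalarTower ℝ ℂ A] (f : L →ₗ⁅ℝ⁆ A) (a : ℂ) (X : L) :
    extendHom f (a ⊗ₜ[ℝ] X) = a • f X := LinearMap.liftBaseChange_tmul _ _ _ _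

/-- The complex universal enveloping algebra `𝒰(𝔤_m)`. -/
abbrev UG (m : ℕ) : Type := UniversalEnvelopingAlgebra ℂ (LieGC m)

/-- The action `R` of `𝒰(𝔤_m)` on `C^∞(G^m)` from the right by left-invariant differential
operators. -/
def R (m : ℕ) : UG m →ₐ[ℂ] Module.End ℂ (Smooth m) :=
  UniversalEnvelopingAlgebra.lift ℂ (extendHom (rightRep m))

/-- An element of `𝔤_m` as an element of `𝒰(𝔤_m)`. -/
def toUG {m : ℕ} (X : LieG m) : UG m := UniversalEnvelopingAlgebra.ι ℂ ((1 : ℂ) ⊗ₜ[ℝ] X)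

theorem R_toUG {m : ℕ} (X : LieG m) (u : Smooth m) (x : G m) :
    (R m (toUG X) u).1 x = deriv (fun t : ℝ => u.1 (x * expG (t • X))) 0 := by
  have h : R m (toUG X) = rightRep m X := by
    rw [R, toUG, UniversalEnvelopingAlgebra.lift_ι_apply, extendHom_tmul, one_smul]
  rw [h]
  rfl

/-! ### The family `𝒟⁰_N(λ)` -/

/-- `Δ_{n-1}`, an element of `𝒰(𝔫_n^-) ⊂ 𝒰(𝔤_n)`, viewed in `𝒰(𝔤_{n+1})`. -/
def Lap (n : ℕ) : UG (n + 1) :=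
  -toUG (Q1minus (n + 1)) ^ 2 + toUG (Q2minus (n + 1)) ^ 2
    + ∑ j ∈ Finset.Icc 1 (n - 3), toUG (Yminus (n + 1) j) ^ 2

/-- `T_n = Y_{n-2}^-`, an element of `𝔫_{n+1}^-`. -/
def T (n : ℕ) : UG (n + 1) := toUG (Yminus (n + 1) (n - 2))

/-- `evenAux n k i` is the coefficient `a_{k-i}(λ)` of `𝒟⁰_{2k}(λ)`. -/
def evenAux (n k : ℕ) : ℕ → Polynomial ℂ
  | 0 => 1
  | i + 1 =>
    Polynomial.C (-((k : ℂ) - i) / ((i + 1) * (2 * i + 1)))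
      * (Polynomial.C ((n : ℂ) - 1 - 4 * k + 2 * (k - i)) + 2 * Polynomial.X) * evenAux n k i

/-- The coefficients `a_j(λ)` of `𝒟⁰_{2k}(λ)`, for `0 ≤ j ≤ k`. -/
def evenCoeff (n k j : ℕ) : Polynomial ℂ := evenAux n k (k - j)

/-- `oddAux n k i` is the coefficient `b_{k-i}(λ)` of `𝒟⁰_{2k+1}(λ)`. -/
def oddAux (n k : ℕ) : ℕ → Polynomial ℂ
  | 0 => 1
  | i + 1 =>
    Polynomial.C (-((k : ℂ) - i) / ((i + 1) * (2 * i + 3)))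
      * (Polynomial.C ((n : ℂ) - 3 - 4 * k + 2 * (k - i)) + 2 * Polynomial.X) * oddAux n k i

/-- The coefficients `b_j(λ)` of `𝒟⁰_{2k+1}(λ)`, for `0 ≤ j ≤ k`. -/
def oddCoeff (n k j : ℕ) : Polynomial ℂ := oddAux n k (k - j)

/-- The coefficients `a_j(λ)` are the unique solution of the recursion below with `a_k = 1`. -/
theorem evenCoeff_unique (n k : ℕ) (lam : ℂ) (a : ℕ → ℂ) :
    (a k = 1 ∧ ∀ j, 1 ≤ j → j ≤ k →
        ((k : ℂ) - j + 1) * (2 * k - 2 * j + 1) * a (j - 1)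
          + j * (n - 1 + 2 * lam - 4 * k + 2 * j) * a j = 0)
      ↔ ∀ j, j ≤ k → a j = (evenCoeff n k j).eval lam := by
  have ne1 : ∀ i : ℕ, (i : ℂ) + 1 ≠ 0 := fun i => by exact_mod_cast Nat.succ_ne_zero i
  have ne2 : ∀ i : ℕ, 2 * (i : ℂ) + 1 ≠ 0 := fun i => by exact_mod_cast Nat.succ_ne_zero (2 * i)
  have step : ∀ i : ℕ, ((i : ℂ) + 1) * (2 * i + 1) * (evenAux n k (i + 1)).eval lam
      = -((k : ℂ) - i)
        * ((n : ℂ) - 1 - 4 * k + 2 * (k - i) + 2 * lam) * (evenAux n k i).eval lam := by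
    intro i
    have hne := mul_ne_zero (ne1 i) (ne2 i)
    simp only [evenAux, Polynomial.eval_mul, Polynomial.eval_add, Polynomial.eval_C,
      Polynomial.eval_X, Polynomial.eval_ofNat]
    rw [← mul_assoc, ← mul_assoc, mul_div_cancel₀ _ hne]
  constructor
  · rintro ⟨h0, h⟩
    have key : ∀ i, i ≤ k → a (k - i) = (evenAux n k i).eval lam := by
      intro i
      induction i with
      | zero => intro _; simpa [evenAux] using h0
      | succ i ih =>
        intro hi
        have h1 := h (k - i) (by omega) (by omega)
        rw [ih (by omega), show k - i - 1 = k - (i + 1) by omega,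
          Nat.cast_sub (show i ≤ k by omega)] at h1
        refine mul_left_cancel₀ (mul_ne_zero (ne1 i) (ne2 i)) ?_
        rw [step i]
        linear_combination h1
    intro j hj
    have := key (k - j) (by omega)
    rwa [show k - (k - j) = j by omega] at this
  · intro h
    refine ⟨by rw [h k le_rfl]; simp [evenCoeff, evenAux], fun j hj hjk => ?_⟩
    obtain ⟨i, rfl⟩ : ∃ i, k = j + i := ⟨k - j, by omega⟩
    rw [h j hjk, h (j - 1) (by omega), evenCoeff, evenCoeff,
      show j + i - (j - 1) = i + 1 by omega, show j + i - j = i by omega]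
    have hs := step i
    push_cast at hs ⊢
    linear_combination hs

/-- The coefficients `b_j(λ)` are the unique solution of the recursion below with `b_k = 1`. -/
theorem oddCoeff_unique (n k : ℕ) (lam : ℂ) (b : ℕ → ℂ) :
    (b k = 1 ∧ ∀ j, 1 ≤ j → j ≤ k →
        ((k : ℂ) - j + 1) * (2 * k - 2 * j + 3) * b (j - 1)
          + j * (n - 3 + 2 * lam - 4 * k + 2 * j) * b j = 0)
      ↔ ∀ j, j ≤ k → b j = (oddCoeff n k j).eval lam := by
  have ne1 : ∀ i : ℕ, (i : ℂ) + 1 ≠ 0 := fun i => by exact_mod_cast Nat.succ_ne_zero i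
  have ne2 : ∀ i : ℕ, 2 * (i : ℂ) + 3 ≠ 0 := fun i => by
    exact_mod_cast Nat.succ_ne_zero (2 * i + 2)
  have step : ∀ i : ℕ, ((i : ℂ) + 1) * (2 * i + 3) * (oddAux n k (i + 1)).eval lam
      = -((k : ℂ) - i)
        * ((n : ℂ) - 3 - 4 * k + 2 * (k - i) + 2 * lam) * (oddAux n k i).eval lam := by
    intro i
    have hne := mul_ne_zero (ne1 i) (ne2 i)
    simp only [oddAux, Polynomial.eval_mul, Polynomial.eval_add, Polynomial.eval_C,
      Polynomial.eval_X, Polynomial.eval_ofNat]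
    rw [← mul_assoc, ← mul_assoc, mul_div_cancel₀ _ hne]
  constructor
  · rintro ⟨h0, h⟩
    have key : ∀ i, i ≤ k → b (k - i) = (oddAux n k i).eval lam := by
      intro i
      induction i with
      | zero => intro _; simpa [oddAux] using h0
      | succ i ih =>
        intro hi
        have h1 := h (k - i) (by omega) (by omega)
        rw [ih (by omega), show k - i - 1 = k - (i + 1) by omega,
          Nat.cast_sub (show i ≤ k by omega)] at h1
        refine mul_left_cancel₀ (mul_ne_zero (ne1 i) (ne2 i)) ?_
        rw [step i]
        linear_combination h1
    intro j hj
    have := key (k - j) (by omega)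
    rwa [show k - (k - j) = j by omega] at this
  · intro h
    refine ⟨by rw [h k le_rfl]; simp [oddCoeff, oddAux], fun j hj hjk => ?_⟩
    obtain ⟨i, rfl⟩ : ∃ i, k = j + i := ⟨k - j, by omega⟩
    rw [h j hjk, h (j - 1) (by omega), oddCoeff, oddCoeff,
      show j + i - (j - 1) = i + 1 by omega, show j + i - j = i by omega]
    have hs := step i
    push_cast at hs ⊢
    linear_combination hs

/-- The polynomial family `𝒟⁰_N(λ)`: for `N = 2k` it is `∑_{j ≤ k} a_j(λ) Δ_{n-1}^j T_n^{2k-2j}`,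
and for `N = 2k+1` it is `∑_{j ≤ k} b_j(λ) Δ_{n-1}^j T_n^{2k-2j+1}`. -/
def D0 (n N : ℕ) (lam : ℂ) : UG (n + 1) :=
  if Even N then
    ∑ j ∈ Finset.range (N / 2 + 1),
      (evenCoeff n (N / 2) j).eval lam • (Lap n ^ j * T n ^ (N - 2 * j))
  else
    ∑ j ∈ Finset.range (N / 2 + 1),
      (oddCoeff n (N / 2) j).eval lam • (Lap n ^ j * T n ^ (N - 2 * j))

theorem E_mul_E {m b : ℕ} (hb : b ≤ m) (a d : ℕ) : E m a b * E m b d = E m a d := by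
  ext i j
  rw [Matrix.mul_apply, Finset.sum_eq_single ⟨b, by omega⟩]
  · by_cases h : i.val = a <;> by_cases h' : j.val = d <;> simp [E, h, h']
  · intro k _ hk
    have hk' : k.val ≠ b := fun h => hk (Fin.ext h)
    simp [E, hk']
  · simp

theorem E_mul_E_of_ne {m b c : ℕ} (h : b ≠ c) (a d : ℕ) : E m a b * E m c d = 0 := by
  ext i j
  rw [Matrix.mul_apply]
  refine Finset.sum_eq_zero fun k _ => ?_
  by_cases hk : k.val = b
  · simp [E, hk, h]
  · simp [E, hk]

theorem mem_nMinus {m : ℕ} {X : LieG m} :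
    X ∈ nMinus m ↔ (H m : Mat m) * (X : Mat m) - (X : Mat m) * (H m : Mat m) = -(X : Mat m) := by
  change ⁅H m, X⁆ = -X ↔ _
  rw [Subtype.ext_iff]
  rfl

theorem Yminus_mem_nMinus {m : ℕ} (hm : 3 ≤ m) {j : ℕ} (hj : 1 ≤ j) :
    Yminus m j ∈ nMinus m := by
  rw [mem_nMinus]
  have h0 : (0 : ℕ) ≤ m := by omega
  have h1 : j ≠ 0 := by omega
  have h2 : 0 ≠ 3 + j := by omega
  simp [H, Yminus, mul_add, add_mul, mul_sub, sub_mul, E_mul_E h0, E_mul_E hm, E_mul_E_of_ne, h1, h2]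
  abel

theorem Q1minus_mem_nMinus {m : ℕ} (hm : 3 ≤ m) : Q1minus m ∈ nMinus m := by
  rw [mem_nMinus]
  have h0 : (0 : ℕ) ≤ m := by omega
  simp [H, Q1minus, mul_add, add_mul, mul_sub, sub_mul, E_mul_E h0, E_mul_E hm, E_mul_E_of_ne]
  abel

theorem Q2minus_mem_nMinus {m : ℕ} (hm : 3 ≤ m) : Q2minus m ∈ nMinus m := by
  rw [mem_nMinus]
  have h0 : (0 : ℕ) ≤ m := by omega
  simp [H, Q2minus, mul_add, add_mul, mul_sub, sub_mul, E_mul_E h0, E_mul_E hm, E_mul_E_of_ne]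
  abel

/-- `𝒰(𝔫_m^-)`, as a subalgebra of `𝒰(𝔤_m)`. -/
def UnMinus (m : ℕ) : Subalgebra ℂ (UG m) :=
  Algebra.adjoin ℂ (toUG '' (nMinus m : Set (LieG m)))

/-- `𝒟⁰_N(λ)` lies in `𝒰(𝔫_{n+1}^-)`. -/
theorem D0_mem_UnMinus {n : ℕ} (hn : 4 ≤ n) (N : ℕ) (lam : ℂ) :
    D0 n N lam ∈ UnMinus (n + 1) := by
  have hmem : ∀ X ∈ nMinus (n + 1), toUG X ∈ UnMinus (n + 1) := fun X hX =>
    Algebra.subset_adjoin ⟨X, hX, rfl⟩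
  have hT : T n ∈ UnMinus (n + 1) := hmem _ (Yminus_mem_nMinus (by omega) (by omega))
  have hL : Lap n ∈ UnMinus (n + 1) :=
    add_mem (add_mem (neg_mem (pow_mem (hmem _ (Q1minus_mem_nMinus (by omega))) 2))
      (pow_mem (hmem _ (Q2minus_mem_nMinus (by omega))) 2))
      (sum_mem fun j hj => pow_mem
        (hmem _ (Yminus_mem_nMinus (by omega) (Finset.mem_Icc.1 hj).1)) 2)
  rw [D0]
  split_ifs <;>
    exact sum_mem fun j _ => Subalgebra.smul_mem _ (mul_mem (pow_mem hL _) (pow_mem hT _)) _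

/-! ### The inclusion `G^n → G^{n+1}` and the restriction `i^*` -/

/-- The block matrix with the blocks `A` and `1`. -/
def blockOne {n : ℕ} (A : Mat n) : Mat (n + 1) :=
  Matrix.reindex finSumFinEquiv finSumFinEquiv
    (Matrix.fromBlocks A 0 0 (1 : Matrix (Fin 1) (Fin 1) ℝ))

theorem blockOne_mul {n : ℕ} (A B : Mat n) : blockOne (A * B) = blockOne A * blockOne B := by
  simp [blockOne, Matrix.submatrix_mul_equiv, Matrix.fromBlocks_multiply]

theorem blockOne_one (n : ℕ) : blockOne (1 : Mat n) = 1 := by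
  simp [blockOne, Matrix.fromBlocks_one]

theorem eta_succ (n : ℕ) : ∃ c : ℝ, eta (n + 1) = Matrix.reindex finSumFinEquiv finSumFinEquiv
    (Matrix.fromBlocks (eta n) 0 0 (c • (1 : Matrix (Fin 1) (Fin 1) ℝ))) := by
  refine ⟨if n + 1 < 2 then -1 else 1, ?_⟩
  rw [← Matrix.diagonal_one, ← Matrix.diagonal_smul, eta, eta, Matrix.fromBlocks_diagonal,
    Matrix.reindex_apply, Matrix.submatrix_diagonal_equiv]
  congr 1
  funext i
  obtain ⟨s, rfl⟩ := finSumFinEquiv.surjective i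
  rcases s with a | b
  · simp
  · by_cases h : n = 0 <;> simp [h]

/-- The inclusion `i : G^n → G^{n+1}`, `g ↦ diag(g, 1)`. -/
def incl (n : ℕ) : G n →* G (n + 1) where
  toFun g := mkG (blockOne (toMat g)) (by
    obtain ⟨c, hc⟩ := eta_succ n
    rw [hc, blockOne]
    simp [Matrix.submatrix_mul_equiv, Matrix.fromBlocks_multiply, Matrix.fromBlocks_transpose,
      toMat_mem])
  map_one' := toMat_injective (by rw [toMat_mkG, toMat_one, toMat_one, blockOne_one])
  map_mul' g h := toMat_injective (blockOne_mul (toMat g) (toMat h))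

theorem toMat_incl {n : ℕ} (g : G n) : toMat (incl n g) = blockOne (toMat g) := rfl

theorem continuous_incl (n : ℕ) : Continuous (incl n) := by
  have h : Continuous fun g : G n => toMat (incl n g) := by
    refine continuous_matrix fun i j => ?_
    obtain ⟨s, rfl⟩ := finSumFinEquiv.surjective i
    obtain ⟨t, rfl⟩ := finSumFinEquiv.surjective j
    simp only [toMat_incl, blockOne, Matrix.reindex_apply, Matrix.submatrix_apply,
      Equiv.symm_apply_apply]
    rcases s with a | a <;> rcases t with b | b
    · exact continuous_toMat.matrix_elem a b
    · exact continuous_const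
    · exact continuous_const
    · exact continuous_const
  refine Continuous.subtype_mk (Units.continuous_iff.2 ⟨h, ?_⟩) _
  change Continuous fun g : G n => eta (n + 1) * (toMat (incl n g))ᵀ * eta (n + 1)
  exact (continuous_const.mul h.matrix_transpose).mul continuous_const

/-- The restriction `i^* : C^∞(G^{n+1}) → C^∞(G^n)`. -/
def iStar (n : ℕ) : Smooth (n + 1) →ₗ[ℂ] Smooth n where
  toFun u := ⟨fun g => u.1 (incl n g), by
    intro g
    obtain ⟨F, hF, h⟩ := u.2 (incl n g)
    refine ⟨fun A => F (fun i j => blockOne (Matrix.of A) i j), hF.comp ?_,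
      (continuous_incl n).continuousAt.eventually h⟩
    refine contDiff_pi.2 fun i => contDiff_pi.2 fun j => ?_
    obtain ⟨s, rfl⟩ := finSumFinEquiv.surjective i
    obtain ⟨t, rfl⟩ := finSumFinEquiv.surjective j
    simp only [blockOne, Matrix.reindex_apply, Matrix.submatrix_apply, Equiv.symm_apply_apply]
    rcases s with a | a <;> rcases t with b | b
    · exact contDiff_apply_apply ℝ ℝ a b
    · exact contDiff_const
    · exact contDiff_const
    · exact contDiff_const⟩
  map_add' _ _ := rfl
  map_smul' _ _ := rfl

theorem iStar_apply {n : ℕ} (u : Smooth (n + 1)) (g : G n) :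
    (iStar n u).1 g = u.1 (incl n g) := rfl

/-! ### Induced representations -/

theorem IsSmooth.leftTranslate {m : ℕ} {f : G m → ℂ} (hf : IsSmooth f) (a : G m) :
    IsSmooth fun x => f (a * x) := by
  intro g
  obtain ⟨F, hF, h⟩ := hf (a * g)
  refine ⟨fun A => F (fun i j => ∑ k, toMat a i k * A k j), hF.comp ?_, ?_⟩
  · refine contDiff_pi.2 fun i => contDiff_pi.2 fun j => ContDiff.sum fun k _ => ?_
    exact contDiff_const.mul (contDiff_apply_apply ℝ ℝ k j)
  · exact (continuous_const.mul continuous_id).continuousAt.eventually h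

/-- The action of `G^m` on `C^∞(G^m)` by left translation, `(g u)(x) = u(g⁻¹ x)`. -/
def leftRep (m : ℕ) : Representation ℂ (G m) (Smooth m) where
  toFun g :=
    { toFun := fun u => ⟨fun x => u.1 (g⁻¹ * x), IsSmooth.leftTranslate u.2 g⁻¹⟩
      map_add' := fun _ _ => rfl
      map_smul' := fun _ _ => rfl }
  map_one' := by
    refine LinearMap.ext fun u => Subtype.ext (funext fun x => ?_)
    change u.1 (1⁻¹ * x) = u.1 x
    rw [inv_one, one_mul]
  map_mul' g h := by
    refine LinearMap.ext fun u => Subtype.ext (funext fun x => ?_)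
    change u.1 ((g * h)⁻¹ * x) = u.1 (h⁻¹ * (g⁻¹ * x))
    rw [mul_inv_rev, mul_assoc]

/-- Let `ι : G^m → G^k` be a homomorphism (below: the identity of `G^m`, or the inclusion of `G^m`
in `G^{m+1}`), let `L` be a subgroup of `G^m` (below: `M^m` or `M̂^m`), `σ` a representation of
`L` on `ℂ` and `λ ∈ ℂ`. This is the space `Ind_Q^{G^k}(ξ_λ ⊗ σ)` for `Q = L A N^+`, where
`A = exp(ℝ H)`, `N^+ = exp(𝔫^+)` and `ξ_λ(exp(t H)) = e^{λ t}`: it consists of all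
`u ∈ C^∞(G^k)` such that `u(g ι(l a n)) = σ(l) ξ_λ(a) u(g)` for `l ∈ L`, `a ∈ A`, `n ∈ N^+`. -/
def Ind {m k : ℕ} (ι : G m →* G k) (L : Subgroup (G m)) (σ : L →* ℂ) (lam : ℂ) :
    Submodule ℂ (Smooth k) where
  carrier := {u | ∀ (g : G k) (l : L) (t : ℝ), ∀ X ∈ nPlus m,
    u.1 (g * ι (l * expG (t • H m) * expG X)) = σ l * Complex.exp (lam * t) * u.1 g}
  add_mem' := by
    intro u v hu hv g l t X hX
    rw [Submodule.coe_add, Pi.add_apply, Pi.add_apply, hu g l t X hX, hv g l t X hX, mul_add]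
  zero_mem' := by
    intro g l t X hX
    rw [Submodule.coe_zero, Pi.zero_apply, Pi.zero_apply, mul_zero]
  smul_mem' := by
    intro c u hu g l t X hX
    rw [Submodule.coe_smul, Pi.smul_apply, Pi.smul_apply, hu g l t X hX, smul_eq_mul, smul_eq_mul]
    ring

theorem leftRep_mem_Ind {m k : ℕ} (ι : G m →* G k) (L : Subgroup (G m)) (σ : L →* ℂ) (lam : ℂ)
    (g : G k) (u : Smooth k) (hu : u ∈ Ind ι L σ lam) : leftRep k g u ∈ Ind ι L σ lam := by
  intro x l t X hX
  change u.1 (g⁻¹ * (x * ι (l * expG (t • H m) * expG X))) = _ * u.1 (g⁻¹ * x)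
  rw [← mul_assoc]
  exact hu (g⁻¹ * x) l t X hX

/-- The representation of `G^k` on the induced space, by left translation. -/
def indRep {m k : ℕ} (ι : G m →* G k) (L : Subgroup (G m)) (σ : L →* ℂ) (lam : ℂ) :
    Representation ℂ (G k) (Ind ι L σ lam) where
  toFun g := (leftRep k g).restrict (leftRep_mem_Ind ι L σ lam g)
  map_one' := by
    refine LinearMap.ext fun u => Subtype.ext ?_
    change leftRep k 1 u.1 = u.1
    rw [map_one]
    rfl
  map_mul' g h := by
    refine LinearMap.ext fun u => Subtype.ext ?_
    change leftRep k (g * h) u.1 = leftRep k g (leftRep k h u.1)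
    rw [map_mul]
    rfl

/-- The representation `σ` of `M`: trivial for even `N`, and `σ_-` for odd `N`. -/
def sigma {m : ℕ} (hm : 3 ≤ m) (N : ℕ) : MGroup m →* ℂ :=
  if Even N then 1 else sigmaMinus hm

end AdSEin
end

open AdSEin

/-! Regard `u` in the source space as a vector of the right regular representation of `𝔤_{n+1}`: it
is killed by `𝔪_{n+1}` and `𝔫_{n+1}^+` and has `H`-weight `λ`. Left translations commute with `R`,
so equivariance is automatic; the content is that `v = R(𝒟⁰_N(λ)) u` transforms correctly under
`M^n`, `A` and `N_n^+`.

`A`: every factor from `𝔫^-` lowers the weight by one and `𝒟⁰_N(λ)` is homogeneous of degree `N`, so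
`v` has weight `λ - N` (`weight_sum`).

`N_n^+`: `v` is a singular vector. Let `x_c`, `y_c` be the raising and lowering operators of the
coordinate `c`; then `[x_c, y_a]` is twice a rotation plus `2⟨e_c, e_a⟩ H` (`lie_raising_lowering`).
For `c` different from the last coordinate this gives `x_c Δ^j T^k u = y_c (k(k-1) Δ^j T^{k-2} +
j(4λ - 4k - 4(j-1) + 2(n-1) - 4) Δ^{j-1} T^k) u` (`raising_quadratic`, `raising_pow`). In `x_c v`
the coefficient of each `y_c Δ^j T^{N-2j-2} u` is then twice the left side of the recursion for the
`a_j` or `b_j`, hence zero (`raising_sum_eq_zero`, `coeffD0_rec`).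

`M^n`: this group is disconnected and is treated without differentiation. An element `l` acts on the
basis vectors of `t₁` and `x₂` by one common sign `ε = l₀₀`, and its image in `G^{n+1}` fixes the
last basis vector. Conjugation by it fixes `Δ` and multiplies `T` by `ε`, so it multiplies `𝒟⁰_N(λ)`
by `ε^N` (`conj_sum`). This is the value of `σ`; on `M̂^n` the sign is `1`.

`rightRep_eq_smul` and `apply_mul_expG` translate between transformation laws along one-parameter
groups and eigenvector equations. -/

noncomputable section

namespace AdSEin

attribute [local instance] LieRing.ofAssociativeRing

/-! ### Null vectors, raising and lowering elements, and their brackets -/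

/-- The standard basis vector of index `a` (counted from `0`) of `ℝ^(m+1)`. -/
def stdVec (m a : ℕ) : Fin (m + 1) → ℝ := fun i => if i.val = a then 1 else 0

theorem stdVec_val {m : ℕ} (a : Fin (m + 1)) : stdVec m a = Pi.single a 1 := by
  ext i
  simp [stdVec, Pi.single_apply, Fin.ext_iff]

theorem E_eq_vecMulVec (m a b : ℕ) : E m a b = Matrix.vecMulVec (stdVec m a) (stdVec m b) := by
  ext i j
  by_cases h : i.val = a <;> by_cases h' : j.val = b <;>
    simp [E, Matrix.vecMulVec_apply, stdVec, h, h']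

theorem stdVec_dotProduct {m a : ℕ} (ha : a ≤ m) (w : Fin (m + 1) → ℝ) :
    stdVec m a ⬝ᵥ w = w ⟨a, Nat.lt_succ_of_le ha⟩ := by
  rw [dotProduct, Finset.sum_eq_single ⟨a, Nat.lt_succ_of_le ha⟩]
  · simp [stdVec]
  · intro k _ hk
    have hk' : k.val ≠ a := fun h => hk (Fin.ext h)
    simp [stdVec, hk']
  · simp

theorem stdVec_dotProduct_stdVec {m a : ℕ} (ha : a ≤ m) (b : ℕ) :
    stdVec m a ⬝ᵥ stdVec m b = if a = b then 1 else 0 := by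
  rw [stdVec_dotProduct ha, stdVec]

theorem eta_mulVec_stdVec (m a : ℕ) : eta m *ᵥ stdVec m a = sgn a • stdVec m a := by
  ext i
  rw [eta, Matrix.mulVec_diagonal]
  by_cases h : i.val = a <;> simp [stdVec, sgn, h]

/-- The bilinear form of signature `(2, m-1)`. -/
def form {m : ℕ} (w v : Fin (m + 1) → ℝ) : ℝ := w ⬝ᵥ (eta m *ᵥ v)

theorem form_comm {m : ℕ} (w v : Fin (m + 1) → ℝ) : form w v = form v w := by
  rw [form, form, Matrix.dotProduct_mulVec, ← Matrix.mulVec_transpose, eta_transpose,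
    dotProduct_comm]

theorem form_stdVec {m a : ℕ} (ha : a ≤ m) (b : ℕ) :
    form (stdVec m a) (stdVec m b) = if a = b then sgn a else 0 := by
  rw [form, eta_mulVec_stdVec, dotProduct_smul, stdVec_dotProduct_stdVec ha]
  split_ifs with h <;> simp [h]

/-- The sum of the basis vectors of the coordinates `t₁` and `x₂`. -/
def nullP (m : ℕ) : Fin (m + 1) → ℝ := stdVec m 0 + stdVec m 3

/-- The difference of the basis vectors of the coordinates `t₁` and `x₂`. -/
def nullQ (m : ℕ) : Fin (m + 1) → ℝ := stdVec m 0 - stdVec m 3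

/-- The vectors `p = nullP` and `q = nullQ` are isotropic and exchanged by `η` up to sign. Hence
`lowering m w` and `raising m w` are `-rotation w q` and `-rotation w p`, which explains why they
lie in `𝔤_m`. -/
theorem eta_mulVec_nullP (m : ℕ) : eta m *ᵥ nullP m = -nullQ m := by
  simp [nullP, nullQ, Matrix.mulVec_add, eta_mulVec_stdVec, sgn]
  abel

theorem eta_mulVec_nullQ (m : ℕ) : eta m *ᵥ nullQ m = -nullP m := by
  simp [nullP, nullQ, Matrix.mulVec_sub, eta_mulVec_stdVec, sgn]
  abel

theorem eta_mul_vecMulVec {m : ℕ} (w v : Fin (m + 1) → ℝ) :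
    eta m * Matrix.vecMulVec w v = Matrix.vecMulVec (eta m *ᵥ w) v := Matrix.mul_vecMulVec _ _ _

theorem vecMulVec_mul_eta {m : ℕ} (w v : Fin (m + 1) → ℝ) :
    Matrix.vecMulVec w v * eta m = Matrix.vecMulVec w (eta m *ᵥ v) := by
  rw [Matrix.vecMulVec_mul, ← Matrix.mulVec_transpose, eta_transpose]

/-- The elements `w pᵗ + q (η w)ᵗ` of `𝔤_m`; for `w` orthogonal to the plane of `t₁, x₂` they
form `𝔫_m^-`. -/
def lowering (m : ℕ) : (Fin (m + 1) → ℝ) →ₗ[ℝ] LieG m where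
  toFun w := ⟨Matrix.vecMulVec w (nullP m) + Matrix.vecMulVec (nullQ m) (eta m *ᵥ w), by
    rw [mem_LieG]
    simp [add_mul, mul_add, Matrix.transpose_vecMulVec, eta_mul_vecMulVec, vecMulVec_mul_eta,
      eta_mulVec_nullQ, add_comm]⟩
  map_add' w v := Subtype.ext (by
    simp [Matrix.mulVec_add, Matrix.add_vecMulVec, Matrix.vecMulVec_add]
    abel)
  map_smul' c w := Subtype.ext (by
    simp [Matrix.mulVec_smul, Matrix.smul_vecMulVec, Matrix.vecMulVec_smul])

/-- The elements `w qᵗ + p (η w)ᵗ` of `𝔤_m`; for `w` orthogonal to the plane of `t₁, x₂` they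
form `𝔫_m^+`. -/
def raising (m : ℕ) : (Fin (m + 1) → ℝ) →ₗ[ℝ] LieG m where
  toFun w := ⟨Matrix.vecMulVec w (nullQ m) + Matrix.vecMulVec (nullP m) (eta m *ᵥ w), by
    rw [mem_LieG]
    simp [add_mul, mul_add, Matrix.transpose_vecMulVec, eta_mul_vecMulVec, vecMulVec_mul_eta,
      eta_mulVec_nullP, add_comm]⟩
  map_add' w v := Subtype.ext (by
    simp [Matrix.mulVec_add, Matrix.add_vecMulVec, Matrix.vecMulVec_add]
    abel)
  map_smul' c w := Subtype.ext (by
    simp [Matrix.mulVec_smul, Matrix.smul_vecMulVec, Matrix.vecMulVec_smul])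

/-- The infinitesimal rotations `w (η v)ᵗ - v (η w)ᵗ`. -/
def rotation {m : ℕ} (w v : Fin (m + 1) → ℝ) : LieG m :=
  ⟨Matrix.vecMulVec w (eta m *ᵥ v) - Matrix.vecMulVec v (eta m *ᵥ w), by
    rw [mem_LieG]
    simp [sub_mul, mul_sub, Matrix.transpose_vecMulVec, eta_mul_vecMulVec, vecMulVec_mul_eta]⟩

theorem coe_lowering {m : ℕ} (w : Fin (m + 1) → ℝ) : (lowering m w : Mat m) =
    Matrix.vecMulVec w (nullP m) + Matrix.vecMulVec (nullQ m) (eta m *ᵥ w) := rfl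

theorem coe_raising {m : ℕ} (w : Fin (m + 1) → ℝ) : (raising m w : Mat m) =
    Matrix.vecMulVec w (nullQ m) + Matrix.vecMulVec (nullP m) (eta m *ᵥ w) := rfl

theorem coe_rotation {m : ℕ} (w v : Fin (m + 1) → ℝ) : (rotation w v : Mat m) =
    Matrix.vecMulVec w (eta m *ᵥ v) - Matrix.vecMulVec v (eta m *ᵥ w) := rfl

theorem nullP_dot_nullP {m : ℕ} (hm : 3 ≤ m) : nullP m ⬝ᵥ nullP m = 2 := by
  simp [nullP, add_dotProduct, dotProduct_add, stdVec_dotProduct_stdVec hm,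
    stdVec_dotProduct_stdVec (Nat.zero_le m)]
  norm_num

theorem nullQ_dot_nullQ {m : ℕ} (hm : 3 ≤ m) : nullQ m ⬝ᵥ nullQ m = 2 := by
  simp [nullQ, sub_dotProduct, dotProduct_sub, stdVec_dotProduct_stdVec hm,
    stdVec_dotProduct_stdVec (Nat.zero_le m)]
  norm_num

theorem nullP_dot_nullQ {m : ℕ} (hm : 3 ≤ m) : nullP m ⬝ᵥ nullQ m = 0 := by
  simp [nullP, nullQ, add_dotProduct, dotProduct_sub, stdVec_dotProduct_stdVec hm,
    stdVec_dotProduct_stdVec (Nat.zero_le m)]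

theorem nullQ_dot_nullP {m : ℕ} (hm : 3 ≤ m) : nullQ m ⬝ᵥ nullP m = 0 := by
  rw [dotProduct_comm, nullP_dot_nullQ hm]

/-- In this form `p` and `q` are visibly eigenvectors of `H` with eigenvalues `1` and `-1`, and
brackets with `H` reduce to scalar products. -/
theorem coe_H (m : ℕ) : (H m : Mat m) =
    (1 / 2 : ℝ) • (Matrix.vecMulVec (nullP m) (nullP m) - Matrix.vecMulVec (nullQ m) (nullQ m)) := by
  simp only [H, E_eq_vecMulVec, nullP, nullQ, Matrix.add_vecMulVec, Matrix.vecMulVec_add,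
    Matrix.sub_vecMulVec, Matrix.vecMulVec_sub]
  module

/-- Orthogonality to the plane of the coordinates `t₁, x₂`. -/
def Transverse {m : ℕ} (w : Fin (m + 1) → ℝ) : Prop := nullP m ⬝ᵥ w = 0 ∧ nullQ m ⬝ᵥ w = 0

theorem transverse_stdVec {m a : ℕ} (hm : 3 ≤ m) (h0 : a ≠ 0) (h3 : a ≠ 3) :
    Transverse (stdVec m a) := by
  simp [Transverse, nullP, nullQ, add_dotProduct, sub_dotProduct, stdVec_dotProduct_stdVec hm,
    stdVec_dotProduct_stdVec (Nat.zero_le m), h0.symm, h3.symm]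

theorem Transverse.eta {m : ℕ} {w : Fin (m + 1) → ℝ} (hw : Transverse w) :
    Transverse (eta m *ᵥ w) := by
  have h : ∀ v, v ⬝ᵥ (AdSEin.eta m *ᵥ w) = (AdSEin.eta m *ᵥ v) ⬝ᵥ w := fun v => by
    rw [Matrix.dotProduct_mulVec, ← Matrix.mulVec_transpose, eta_transpose]
  refine ⟨?_, ?_⟩
  · rw [h, eta_mulVec_nullP, neg_dotProduct, hw.2, neg_zero]
  · rw [h, eta_mulVec_nullQ, neg_dotProduct, hw.1, neg_zero]

theorem Transverse.dot_nullP {m : ℕ} {w : Fin (m + 1) → ℝ} (hw : Transverse w) :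
    w ⬝ᵥ nullP m = 0 := by rw [dotProduct_comm, hw.1]

theorem Transverse.dot_nullQ {m : ℕ} {w : Fin (m + 1) → ℝ} (hw : Transverse w) :
    w ⬝ᵥ nullQ m = 0 := by rw [dotProduct_comm, hw.2]

/-- Products of rank-one matrices collapse to scalar products. Transversality and `p ⬝ q = 0` remove
the mixed terms, `p ⬝ p = q ⬝ q = 2` gives the rotation, and the remaining `p pᵗ` and `q qᵗ` combine
to a multiple of `H`. -/
theorem lie_raising_lowering {m : ℕ} (hm : 3 ≤ m) {w v : Fin (m + 1) → ℝ} (hw : Transverse w)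
    (hv : Transverse v) :
    ⁅raising m w, lowering m v⁆ = (2 : ℝ) • rotation w v + (2 * form w v) • H m := by
  have h1 : (eta m *ᵥ w) ⬝ᵥ v = form w v := by rw [form_comm, form, dotProduct_comm]
  have h2 : (eta m *ᵥ v) ⬝ᵥ w = form w v := by rw [form, dotProduct_comm]
  refine Subtype.ext ?_
  simp only [LieSubalgebra.coe_bracket, LieRing.of_associative_ring_bracket, coe_raising,
    coe_lowering, AddMemClass.coe_add, SetLike.val_smul, coe_rotation, coe_H, add_mul,
    mul_add, Matrix.vecMulVec_mul_vecMulVec, hv.2, hw.1, h1, h2,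
    nullP_dot_nullP hm, nullQ_dot_nullQ hm, hw.eta.dot_nullQ, hv.eta.dot_nullP,
    Matrix.vecMulVec_smul]
  module

theorem lie_rotation_lowering {m : ℕ} {w v z : Fin (m + 1) → ℝ} (hw : Transverse w)
    (hv : Transverse v) :
    ⁅rotation w v, lowering m z⁆ = form v z • lowering m w - form w z • lowering m v := by
  have h1 : ∀ x : Fin (m + 1) → ℝ, (eta m *ᵥ x) ⬝ᵥ z = form x z := fun x => by
    rw [form_comm, form, dotProduct_comm]
  have h2 : ∀ x : Fin (m + 1) → ℝ, (eta m *ᵥ z) ⬝ᵥ x = form x z := fun x => by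
    rw [form, dotProduct_comm]
  refine Subtype.ext ?_
  simp only [LieSubalgebra.coe_bracket, LieRing.of_associative_ring_bracket,
    coe_lowering, AddSubgroupClass.coe_sub, SetLike.val_smul, coe_rotation, sub_mul, mul_sub,
    add_mul, mul_add, Matrix.vecMulVec_mul_vecMulVec, hv.1, hw.1, h1, h2, hw.eta.dot_nullQ,
    hv.eta.dot_nullQ, Matrix.vecMulVec_smul]
  module

theorem lie_lowering_lowering {m : ℕ} (hm : 3 ≤ m) {w v : Fin (m + 1) → ℝ} (hw : Transverse w)
    (hv : Transverse v) : ⁅lowering m w, lowering m v⁆ = 0 := by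
  have h1 : (eta m *ᵥ w) ⬝ᵥ v = form w v := by rw [form_comm, form, dotProduct_comm]
  have h2 : (eta m *ᵥ v) ⬝ᵥ w = form w v := by rw [form, dotProduct_comm]
  refine Subtype.ext ?_
  simp only [LieSubalgebra.coe_bracket, LieRing.of_associative_ring_bracket,
    coe_lowering, add_mul, mul_add, Matrix.vecMulVec_mul_vecMulVec, hv.1, hw.1, h1, h2,
    nullP_dot_nullQ hm, hw.eta.dot_nullQ, hv.eta.dot_nullQ, Matrix.vecMulVec_smul]
  simp

theorem lie_H_lowering {m : ℕ} (hm : 3 ≤ m) {w : Fin (m + 1) → ℝ} (hw : Transverse w) :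
    ⁅H m, lowering m w⁆ = -lowering m w := by
  refine Subtype.ext ?_
  simp only [LieSubalgebra.coe_bracket, LieRing.of_associative_ring_bracket, coe_H,
    coe_lowering, NegMemClass.coe_neg, sub_mul, mul_sub, add_mul, mul_add, smul_mul_assoc,
    mul_smul_comm, Matrix.vecMulVec_mul_vecMulVec, hw.1, hw.2, nullP_dot_nullP hm,
    nullQ_dot_nullQ hm, nullP_dot_nullQ hm, hw.eta.dot_nullQ, hw.eta.dot_nullP,
    Matrix.vecMulVec_smul]
  module

theorem Yminus_eq (m j : ℕ) : Yminus m j = lowering m (stdVec m (3 + j)) := by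
  refine Subtype.ext ?_
  simp only [Yminus, E_eq_vecMulVec, coe_lowering, eta_mulVec_stdVec, sgn,
    show ¬ 3 + j < 2 by omega, if_false, nullP, nullQ, Matrix.vecMulVec_add,
    Matrix.sub_vecMulVec, Matrix.vecMulVec_smul]
  module

theorem Q1minus_eq (m : ℕ) : Q1minus m = lowering m (stdVec m 1) := by
  refine Subtype.ext ?_
  simp only [Q1minus, E_eq_vecMulVec, coe_lowering, eta_mulVec_stdVec, sgn,
    show 1 < 2 by omega, if_true, nullP, nullQ, Matrix.vecMulVec_add,
    Matrix.sub_vecMulVec, Matrix.vecMulVec_smul]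
  module

theorem Q2minus_eq (m : ℕ) : Q2minus m = lowering m (stdVec m 2) := by
  refine Subtype.ext ?_
  simp only [Q2minus, E_eq_vecMulVec, coe_lowering, eta_mulVec_stdVec, sgn,
    show ¬ 2 < 2 by omega, if_false, nullP, nullQ, Matrix.vecMulVec_add,
    Matrix.sub_vecMulVec, Matrix.vecMulVec_smul]
  module

theorem rotation_swap {m : ℕ} (w v : Fin (m + 1) → ℝ) : rotation v w = -rotation w v :=
  Subtype.ext (by simp [coe_rotation])

/-- Up to sign these are the `M_{ij}`, `H₂`, and the half sums and half differences of `Z_j^+` and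
`Z_j^-`, which rotate the coordinate `3 + j` against the coordinates `1` and `2`. -/
theorem rotation_mem_mAlg {m a b : ℕ} (ha : a ≤ m) (hb : b ≤ m) (ha0 : a ≠ 0) (ha3 : a ≠ 3)
    (hb0 : b ≠ 0) (hb3 : b ≠ 3) : rotation (stdVec m a) (stdVec m b) ∈ mAlg m := by
  have hz : ∀ j, 1 ≤ j → j ≤ m - 3 → Zplus m j ∈ mAlg m ∧ Zminus m j ∈ mAlg m := fun j h1 h2 =>
    ⟨Submodule.subset_span (Or.inl (Or.inr ⟨j, h1, h2, Or.inl rfl⟩)),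
      Submodule.subset_span (Or.inl (Or.inr ⟨j, h1, h2, Or.inr rfl⟩))⟩
  have key : ∀ a b : ℕ, a ≤ b → b ≤ m → a ≠ 0 → a ≠ 3 → b ≠ 3 →
      rotation (stdVec m a) (stdVec m b) ∈ mAlg m := by
    intro a b hab hb ha0 ha3 hb3
    rcases eq_or_lt_of_le hab with rfl | hab
    · convert (mAlg m).zero_mem
      exact Subtype.ext (by simp [coe_rotation])
    by_cases h4 : 4 ≤ a
    · obtain ⟨i, rfl⟩ : ∃ i, a = 3 + i := ⟨a - 3, by omega⟩
      obtain ⟨j, rfl⟩ : ∃ j, b = 3 + j := ⟨b - 3, by omega⟩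
      have h : Mrot m i j ∈ mAlg m := Submodule.subset_span
        (Or.inl (Or.inl ⟨i, j, by omega, by omega, by omega, by omega, rfl⟩))
      convert h
      refine Subtype.ext ?_
      simp only [Mrot, E_eq_vecMulVec, coe_rotation, eta_mulVec_stdVec, sgn,
        show ∀ k, ¬ 3 + k < 2 by omega, if_false, Matrix.vecMulVec_smul]
      module
    by_cases hb2 : b = 2
    · obtain rfl : a = 1 := by omega
      subst hb2
      have h : H2 m ∈ mAlg m := Submodule.subset_span (Or.inr rfl)
      convert h
      refine Subtype.ext ?_
      simp only [H2, E_eq_vecMulVec, coe_rotation, eta_mulVec_stdVec, sgn, Matrix.vecMulVec_smul]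
      norm_num
    obtain ⟨j, rfl⟩ : ∃ j, b = 3 + j := ⟨b - 3, by omega⟩
    obtain ⟨h1, h2⟩ := hz j (by omega) (by omega)
    have ha12 : a = 1 ∨ a = 2 := by omega
    rcases ha12 with rfl | rfl
    · convert (mAlg m).smul_mem (1 / 2 : ℝ) (add_mem h1 h2)
      refine Subtype.ext ?_
      simp only [Zplus, Zminus, E_eq_vecMulVec, coe_rotation, eta_mulVec_stdVec, sgn,
        Matrix.vecMulVec_smul, AddMemClass.coe_add, SetLike.val_smul,
        show ∀ k, ¬ 3 + k < 2 by omega, if_false, show 1 < 2 by omega, if_true]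
      module
    · convert (mAlg m).smul_mem (1 / 2 : ℝ) (sub_mem h1 h2)
      refine Subtype.ext ?_
      simp only [Zplus, Zminus, E_eq_vecMulVec, coe_rotation, eta_mulVec_stdVec, sgn,
        Matrix.vecMulVec_smul, AddSubgroupClass.coe_sub, SetLike.val_smul,
        show ∀ k, ¬ 3 + k < 2 by omega, if_false, show ¬ 2 < 2 by omega]
      module
  rcases le_total a b with h | h
  · exact key a b h hb ha0 ha3 hb3
  · rw [rotation_swap]
    exact neg_mem (key b a h ha hb0 hb3 ha3)

/-! ### The shape of `𝔫^+` and conjugation of lowering elements -/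

theorem LieG_apply {m : ℕ} (X : LieG m) (i j : Fin (m + 1)) :
    (X : Mat m) j i * sgn j = -(sgn i * (X : Mat m) i j) := by
  have h := congrFun (congrFun (mem_LieG.1 X.2) i) j
  rw [eta, Matrix.mul_diagonal, Matrix.diagonal_mul, Matrix.transpose_apply, Matrix.neg_apply,
    mul_neg] at h
  exact h

/-- An element of `𝔫^+` is determined by its first column, which is transverse. -/
theorem nPlus_eq_raising {m : ℕ} (hm : 3 ≤ m) {X : LieG m} (hX : X ∈ nPlus m) :
    X = raising m (fun i => (X : Mat m) i 0) ∧ (X : Mat m) 0 0 = 0 ∧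
      (X : Mat m) ⟨3, by omega⟩ 0 = 0 := by
  have hH : (H m : Mat m) * (X : Mat m) - (X : Mat m) * (H m : Mat m) = X :=
    congrArg Subtype.val (hX : ⁅H m, X⁆ = X)
  let t : Fin (m + 1) := ⟨3, by omega⟩
  have row : ∀ (a : ℕ) (ha : a ≤ m) (j : Fin (m + 1)),
      (stdVec m a ᵥ* (X : Mat m)) j = (X : Mat m) ⟨a, by omega⟩ j := fun a ha j => by
    rw [Matrix.vecMul, stdVec_dotProduct ha]
  have col : ∀ (a : ℕ) (ha : a ≤ m) (j : Fin (m + 1)),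
      ((X : Mat m) *ᵥ stdVec m a) j = (X : Mat m) j ⟨a, by omega⟩ := fun a ha j => by
    rw [Matrix.mulVec, dotProduct_comm, stdVec_dotProduct ha]
  -- These are the entries of `[H, X] = X`. They vanish for `i, j` both outside `{0, 3}` and give
  -- `X_{i3} = -X_{i0}` for such `i`; skewness with respect to `η` supplies the rows `0` and `3`.
  have h : ∀ i j, stdVec m 0 i * (X : Mat m) t j + stdVec m 3 i * (X : Mat m) 0 j
      - ((X : Mat m) i 0 * stdVec m 3 j + (X : Mat m) i t * stdVec m 0 j) = (X : Mat m) i j := by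
    intro i j
    have h1 := congrFun (congrFun hH i) j
    simp only [H, E_eq_vecMulVec, add_mul, mul_add, Matrix.vecMulVec_mul, Matrix.mul_vecMulVec,
      Matrix.sub_apply, Matrix.add_apply, Matrix.vecMulVec_apply, row 3 hm, row 0 (Nat.zero_le m),
      col 3 hm, col 0 (Nat.zero_le m)] at h1
    exact h1
  have hs := LieG_apply X
  have hval : ∀ k : Fin (m + 1), k = 0 ∨ k = t ∨ (k.val ≠ 0 ∧ k.val ≠ 3) := fun k => by
    simp only [Fin.ext_iff, t]
    simp
    omega
  have e00 := hs 0 0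
  have e0t := hs 0 t
  have ett := hs t t
  have s0 : sgn ((0 : Fin (m + 1)) : ℕ) = -1 := by simp [sgn]
  have st : sgn ((t : Fin (m + 1)) : ℕ) = 1 := by simp [sgn, t]
  have v00 : stdVec m 0 0 = 1 := by simp [stdVec]
  have v30 : stdVec m 3 0 = 0 := by simp [stdVec]
  have v0t : stdVec m 0 t = 0 := by simp [stdVec, t]
  have v3t : stdVec m 3 t = 1 := by simp [stdVec, t]
  have vo : ∀ k : Fin (m + 1), k.val ≠ 0 ∧ k.val ≠ 3 → stdVec m 0 k = 0 ∧ stdVec m 3 k = 0 :=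
    fun k hk => by simp [stdVec, hk.1, hk.2]
  have h0t := h 0 t
  refine ⟨?_, ?_, ?_⟩
  rotate_left
  · simp only [s0] at e00
    linarith
  · change (X : Mat m) t 0 = 0
    simp only [s0, st, v00, v30, v0t, v3t] at *
    linarith
  refine Subtype.ext (Matrix.ext fun i j => ?_)
  rw [coe_raising, Matrix.add_apply, Matrix.vecMulVec_apply, Matrix.vecMulVec_apply, eta,
    Matrix.mulVec_diagonal]
  change _ = (X : Mat m) i 0 * nullQ m j + nullP m i * (sgn j * (X : Mat m) j 0)
  simp only [nullP, nullQ, Pi.add_apply, Pi.sub_apply]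
  have hij := h i j
  have h0j := h 0 j
  have hs0 := hs 0 j
  rcases hval i with rfl | rfl | hi <;> rcases hval j with rfl | rfl | hj <;>
    simp only [s0, st, v00, v30, v0t, v3t] at * <;>
    (try rw [(vo i hi).1, (vo i hi).2] at *) <;>
    (try rw [(vo j hj).1, (vo j hj).2] at *) <;> linarith

/-- If `p` scales the line of `q` and, from the right, the row vector `nullP` by the same sign `ε`,
then conjugation by `p` preserves the lowering elements and acts on their parameter as `w ↦ ε p w`.
The second summand uses `pᵗ η p = η`. -/
theorem mul_lowering {m : ℕ} (p : G m) {ε : ℝ} (hε : ε * ε = 1)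
    (hq : toMat p *ᵥ nullQ m = ε • nullQ m) (hp : nullP m ᵥ* toMat p = ε • nullP m)
    (w : Fin (m + 1) → ℝ) :
    toMat p * (lowering m w : Mat m)
      = (lowering m (ε • (toMat p *ᵥ w)) : Mat m) * toMat p := by
  have h : (eta m *ᵥ (toMat p *ᵥ w)) ᵥ* toMat p = eta m *ᵥ w := by
    rw [← Matrix.mulVec_transpose, Matrix.mulVec_mulVec, Matrix.mulVec_mulVec, toMat_mem]
  rw [map_smul, SetLike.val_smul, coe_lowering, coe_lowering, mul_add, smul_mul_assoc, add_mul,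
    Matrix.mul_vecMulVec, Matrix.mul_vecMulVec, Matrix.vecMulVec_mul, Matrix.vecMulVec_mul, h, hq,
    hp, Matrix.vecMulVec_smul, Matrix.smul_vecMulVec, smul_add, smul_smul, hε, one_smul]

/-! ### The singular vector computation for abstract operators -/

section Operators

variable {V : Type*} [AddCommGroup V] [Module ℂ V]

/-- The commutator of a raising operator with the quadratic element, applied to a vector which is
annihilated by the rotations and is a weight vector. -/
theorem raising_quadratic (S : Finset ℕ) {c : ℕ} (hc : c ∈ S) (s : ℕ → ℂ)
    (hs : ∀ a, s a * s a = 1) (y r : ℕ → Module.End ℂ V) (x h : Module.End ℂ V)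
    (hx : ∀ a ∈ S, ∀ z, x (y a z) = y a (x z) + (2 : ℂ) • r a z
      + (2 * if c = a then s c else 0) • h z)
    (hr : ∀ a ∈ S, ∀ z, r a (y a z) = y a (r a z) + s a • y c z - (if c = a then s c else 0) • y a z)
    (hh : ∀ z, h (y c z) = y c (h z) - y c z) {w : V} (hw : ∀ a ∈ S, r a w = 0) {μ : ℂ}
    (hμ : h w = μ • w) :
    x (∑ a ∈ S, s a • y a (y a w))
      = ∑ a ∈ S, s a • y a (y a (x w)) + (4 * μ - 4 + 2 * S.card) • y c w := by
  -- For `a ≠ c` the rotation term contributes `2`. For `a = c` the rotation term vanishes and `h`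
  -- is met twice, on weights `μ` and `μ - 1`, which gives `2μ + 2(μ - 1) = (4μ - 4) + 2`.
  have key : ∀ a ∈ S, x (s a • y a (y a w)) = s a • y a (y a (x w))
      + ((if c = a then (4 * μ - 4) else 0) + 2) • y c w := by
    intro a ha
    rw [map_smul, hx a ha, hx a ha, hr a ha, hw a ha, hμ]
    by_cases hca : c = a
    · subst hca
      rw [hh, hμ]
      simp only [if_true, map_add, map_smul, map_zero, smul_zero]
      have := hs c
      match_scalars
      · ring
      · linear_combination (4 * μ - 2) * this
    · simp only [if_neg hca, map_add, map_zero, smul_zero, mul_zero, zero_smul]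
      have := hs a
      match_scalars
      · ring
      · linear_combination 2 * this
  rw [map_sum, Finset.sum_congr rfl key, Finset.sum_add_distrib, ← Finset.sum_smul,
    Finset.sum_add_distrib, Finset.sum_ite_eq, if_pos hc, Finset.sum_const, nsmul_eq_mul,
    mul_comm (2 : ℂ)]

/-- An infinitesimal rotation preserves the quadratic form: the terms `y c * y a + y a * y c`
produced by `b = a` cancel those produced by `b = c`. This needs both indices in `S`. -/
theorem commute_rotation_quadratic (S : Finset ℕ) {c a : ℕ} (hc : c ∈ S) (ha : a ∈ S) (s : ℕ → ℂ)
    (hs : ∀ a, s a * s a = 1) (y : ℕ → Module.End ℂ V) (r : Module.End ℂ V)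
    (hr : ∀ b ∈ S, r * y b = y b * r + (if a = b then s a else 0) • y c
      - (if c = b then s c else 0) • y a) :
    Commute r (∑ b ∈ S, s b • (y b * y b)) := by
  have key : ∀ b ∈ S, r * (s b • (y b * y b)) = s b • (y b * y b) * r
      + ((if a = b then (y c * y a + y a * y c) else 0)
      - (if c = b then (y a * y c + y c * y a) else 0)) := by
    intro b hb
    have h2 : r * (y b * y b) = y b * y b * r
        + (if a = b then s a else 0) • (y c * y b + y b * y c)
        - (if c = b then s c else 0) • (y a * y b + y b * y a) := by
      rw [← mul_assoc, hr b hb, sub_mul, add_mul, mul_assoc, hr b hb]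
      simp only [mul_sub, mul_add, smul_mul_assoc, mul_smul_comm, mul_assoc]
      module
    rw [mul_smul_comm, h2, smul_mul_assoc]
    by_cases h1 : a = b <;> by_cases h3 : c = b
    · subst h1; subst h3
      simp
    · subst h1
      simp only [if_true, if_neg h3, zero_smul, sub_zero, add_zero, smul_add, smul_smul, hs,
        one_smul]
    · subst h3
      simp only [if_true, if_neg h1, zero_smul, add_zero, zero_sub, smul_sub, smul_add, smul_smul,
        hs, one_smul]
      abel
    · simp [h1, h3]
  rw [commute_iff_eq, Finset.mul_sum, Finset.sum_congr rfl key, Finset.sum_add_distrib,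
    Finset.sum_sub_distrib, Finset.sum_ite_eq, Finset.sum_ite_eq, if_pos hc, if_pos ha,
    Finset.sum_mul]
  abel

/-- Since `[r, T] = y`, the vector `r T^k v` equals `k y T^{k-1} v`; summing the contributions `2r`
of `[x, T]` gives `k(k-1)`. Then `i` running from `0` to `j - 1` adds `4(λ - 2i - k) + κ` at each
factor `D`, with total `j(4λ - 4k - 4(j-1) + κ)`. Where an exponent `k - 2` or `j - 1` is truncated,
its coefficient is zero. Commutation of `r` with `D` is not needed, because `r` only meets powers of
`T`. -/
theorem raising_pow {x y D T r : Module.End ℂ V} {v : V} {lam κ : ℂ}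
    (hyD : Commute y D) (hyT : Commute y T)
    (hxT : ∀ z, x (T z) = T (x z) + (2 : ℂ) • r z) (hrT : ∀ z, r (T z) = T (r z) + y z)
    (hrv : r v = 0) (hxv : x v = 0)
    (hxD : ∀ j k : ℕ, x (D ((D ^ j * T ^ k) v)) = D (x ((D ^ j * T ^ k) v))
      + (4 * (lam - 2 * j - k) + κ) • y ((D ^ j * T ^ k) v)) (j k : ℕ) :
    x ((D ^ j * T ^ k) v) = y (((k : ℂ) * (k - 1)) • (D ^ j * T ^ (k - 2)) v
      + ((j : ℂ) * (4 * lam - 4 * k - 4 * (j - 1) + κ)) • (D ^ (j - 1) * T ^ k) v) := by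
  have hTy : ∀ z, T (y z) = y (T z) := fun z => (LinearMap.congr_fun hyT.eq z).symm
  have hDy : ∀ z, D (y z) = y (D z) := fun z => (LinearMap.congr_fun hyD.eq z).symm
  have hr : ∀ k : ℕ, r ((T ^ k) v) = (k : ℂ) • y ((T ^ (k - 1)) v) := by
    intro k
    induction k with
    | zero => simp [hrv]
    | succ k ih =>
      rw [pow_succ', Module.End.mul_apply, hrT, ih, map_smul, hTy, ← Module.End.mul_apply T]
      rcases k with _ | k
      · simp
      · simp only [← pow_succ', Nat.add_sub_cancel]
        push_cast
        module
  induction j with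
  | zero =>
    simp only [pow_zero, one_mul, Nat.cast_zero, zero_mul, zero_smul, add_zero]
    induction k with
    | zero => simp [hxv]
    | succ k ih =>
      rw [pow_succ', Module.End.mul_apply, hxT, ih, hr, map_smul, map_smul, map_smul, hTy,
        ← Module.End.mul_apply T]
      rcases k with _ | _ | k
      · simp
      · norm_num
      · simp only [← pow_succ', Nat.add_sub_cancel, show k + 1 + 1 + 1 - 2 = k + 1 by omega]
        push_cast
        module
  | succ j ih =>
    rw [pow_succ', mul_assoc, Module.End.mul_apply, hxD, ih, hDy, map_add D, map_smul D,
      map_smul D, ← Module.End.mul_apply D, ← Module.End.mul_apply D, ← mul_assoc, ← mul_assoc,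
      ← pow_succ', ← map_smul y, ← map_add y]
    congr 1
    rcases j with _ | j
    · simp
      module
    · simp only [← pow_succ', Nat.add_sub_cancel]
      push_cast
      module

/-- The recursion for the coefficients makes the sum a singular vector. -/
theorem raising_sum_eq_zero {x y D T : Module.End ℂ V} {v : V} {lam κ : ℂ} (N : ℕ)
    (hx : ∀ j k : ℕ, x ((D ^ j * T ^ k) v) = y (((k : ℂ) * (k - 1)) • (D ^ j * T ^ (k - 2)) v
      + ((j : ℂ) * (4 * lam - 4 * k - 4 * (j - 1) + κ)) • (D ^ (j - 1) * T ^ k) v))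
    (c : ℕ → ℂ)
    (hc : ∀ j, j < N / 2 → ((N : ℂ) - 2 * j) * (N - 2 * j - 1) * c j
      + (j + 1) * (4 * lam - 4 * (N - 2 * (j + 1)) - 4 * j + κ) * c (j + 1) = 0) :
    x ((∑ j ∈ Finset.range (N / 2 + 1), c j • (D ^ j * T ^ (N - 2 * j))) v) = 0 := by
  have hcast : ∀ j, j < N / 2 + 1 → ((N - 2 * j : ℕ) : ℂ) = N - 2 * j := fun j hj => by
    rw [Nat.cast_sub (by omega)]
    push_cast
    ring
  have h1 : ∀ j ∈ Finset.range (N / 2 + 1), x ((c j • (D ^ j * T ^ (N - 2 * j))) v) =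
      y ((c j * (((N : ℂ) - 2 * j) * (N - 2 * j - 1))) • (D ^ j * T ^ (N - 2 * (j + 1))) v)
      + y ((c j * (j * (4 * lam - 4 * (N - 2 * j) - 4 * (j - 1) + κ)))
        • (D ^ (j - 1) * T ^ (N - 2 * j)) v) := by
    intro j hj
    rw [LinearMap.smul_apply, map_smul, hx, hcast j (Finset.mem_range.1 hj), ← map_smul, smul_add,
      map_add, smul_smul, smul_smul, show N - 2 * j - 2 = N - 2 * (j + 1) by omega]
  -- Splitting off the top term of the first family and the bottom term of the second lets index `j`
  -- of the first and `j + 1` of the second meet in the same monomial `D^j T^{N-2(j+1)}`.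
  rw [LinearMap.sum_apply, map_sum, Finset.sum_congr rfl h1, Finset.sum_add_distrib,
    Finset.sum_range_succ, Finset.sum_range_succ' _ (N / 2)]
  -- At the top `N - 2⌊N/2⌋` is `0` or `1`, so `k(k-1)` vanishes there; the bottom term of the other
  -- family carries the factor `j = 0`.
  have h2 : ((N : ℂ) - 2 * (N / 2 : ℕ)) * (N - 2 * (N / 2 : ℕ) - 1) = 0 := by
    rcases Nat.even_or_odd' N with ⟨k, rfl | rfl⟩
    · rw [show 2 * k / 2 = k by omega]
      push_cast
      ring
    · rw [show (2 * k + 1) / 2 = k by omega]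
      push_cast
      ring
  rw [h2]
  simp only [mul_zero, zero_smul, map_zero, add_zero, Nat.cast_zero, zero_mul]
  rw [← Finset.sum_add_distrib]
  refine Finset.sum_eq_zero fun j hj => ?_
  rw [← map_add, Nat.add_sub_cancel, ← add_smul]
  have := hc j (Finset.mem_range.1 hj)
  push_cast
  rw [show c j * (((N : ℂ) - 2 * j) * (N - 2 * j - 1)) + c (j + 1) * ((j + 1)
    * (4 * lam - 4 * (N - 2 * (j + 1)) - 4 * ((j + 1 : ℂ) - 1) + κ)) = 0 by
      linear_combination this, zero_smul, map_zero]

theorem weight_quadratic {ι : Type*} (S : Finset ι) (s : ι → ℂ) (y : ι → Module.End ℂ V)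
    (h : Module.End ℂ V) (hy : ∀ a ∈ S, ∀ z, h (y a z) = y a (h z) - y a z) (z : V) :
    h ((∑ a ∈ S, s a • (y a * y a)) z)
      = (∑ a ∈ S, s a • (y a * y a)) (h z) - (2 : ℂ) • (∑ a ∈ S, s a • (y a * y a)) z := by
  simp only [LinearMap.sum_apply, LinearMap.smul_apply, Module.End.mul_apply, map_sum,
    Finset.smul_sum, ← Finset.sum_sub_distrib]
  refine Finset.sum_congr rfl fun a ha => ?_
  rw [map_smul, hy a ha, hy a ha, map_sub]
  module

theorem weight_monomial {h D T : Module.End ℂ V} {v : V} {lam : ℂ}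
    (hD : ∀ z, h (D z) = D (h z) - (2 : ℂ) • D z) (hT : ∀ z, h (T z) = T (h z) - T z)
    (hv : h v = lam • v) (j k : ℕ) :
    h ((D ^ j * T ^ k) v) = (lam - 2 * j - k) • (D ^ j * T ^ k) v := by
  induction j with
  | zero =>
    induction k with
    | zero => simpa using hv
    | succ k ih =>
      rw [pow_zero, one_mul] at ih ⊢
      rw [pow_succ', Module.End.mul_apply, hT, ih, map_smul]
      push_cast
      module
  | succ j ih =>
    rw [pow_succ', mul_assoc, Module.End.mul_apply, hD, ih, map_smul]
    push_cast
    module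

theorem weight_sum {h D T : Module.End ℂ V} {v : V} {lam : ℂ}
    (hw : ∀ j k : ℕ, h ((D ^ j * T ^ k) v) = (lam - 2 * j - k) • (D ^ j * T ^ k) v) (N : ℕ)
    (c : ℕ → ℂ) :
    h ((∑ j ∈ Finset.range (N / 2 + 1), c j • (D ^ j * T ^ (N - 2 * j))) v)
      = (lam - N) • (∑ j ∈ Finset.range (N / 2 + 1), c j • (D ^ j * T ^ (N - 2 * j))) v := by
  rw [LinearMap.sum_apply, map_sum, Finset.smul_sum]
  refine Finset.sum_congr rfl fun j hj => ?_
  have hj' := Finset.mem_range.1 hj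
  rw [LinearMap.smul_apply, map_smul, hw, smul_comm, Nat.cast_sub (by omega)]
  push_cast
  congr 1
  ring_nf

end Operators

theorem lie_H_raising {m : ℕ} (hm : 3 ≤ m) {w : Fin (m + 1) → ℝ} (hw : Transverse w) :
    ⁅H m, raising m w⁆ = raising m w := by
  refine Subtype.ext ?_
  simp only [LieSubalgebra.coe_bracket, LieRing.of_associative_ring_bracket, coe_H,
    coe_raising, sub_mul, mul_sub, add_mul, mul_add, smul_mul_assoc,
    mul_smul_comm, Matrix.vecMulVec_mul_vecMulVec, hw.1, hw.2, nullP_dot_nullP hm,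
    nullQ_dot_nullQ hm, nullQ_dot_nullP hm, hw.eta.dot_nullQ, hw.eta.dot_nullP,
    Matrix.vecMulVec_smul]
  module

theorem R_toUG_eq {m : ℕ} (X : LieG m) : R m (toUG X) = rightRep m X := by
  rw [R, toUG, UniversalEnvelopingAlgebra.lift_ι_apply, extendHom_tmul, one_smul]

/-! ### Transverse coordinates and a uniform recursion for the coefficients -/

/-- The indices of the coordinates of `ℝ^(n+1)` other than `t₁, x₂`. -/
def transverseIndices (n : ℕ) : Finset ℕ := {a ∈ Finset.range (n + 1) | a ≠ 0 ∧ a ≠ 3}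

theorem mem_transverseIndices {n a : ℕ} :
    a ∈ transverseIndices n ↔ a ≤ n ∧ a ≠ 0 ∧ a ≠ 3 := by
  simp [transverseIndices]

theorem transverseIndices_eq {n : ℕ} (hn : 3 ≤ n) : transverseIndices n =
    insert 1 (insert 2 ((Finset.Icc 1 (n - 3)).map (addLeftEmbedding 3))) := by
  ext a
  simp only [mem_transverseIndices, Finset.mem_insert, Finset.mem_map, Finset.mem_Icc,
    addLeftEmbedding_apply]
  constructor
  · intro h
    by_cases h1 : a = 1
    · exact Or.inl h1
    by_cases h2 : a = 2
    · exact Or.inr (Or.inl h2)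
    exact Or.inr (Or.inr ⟨a - 3, by omega, by omega⟩)
  · rintro (rfl | rfl | ⟨j, h, rfl⟩) <;> omega

theorem sum_transverseIndices {M : Type*} [AddCommMonoid M] {n : ℕ} (hn : 3 ≤ n) (f : ℕ → M) :
    ∑ a ∈ transverseIndices n, f a = f 1 + (f 2 + ∑ j ∈ Finset.Icc 1 (n - 3), f (3 + j)) := by
  rw [transverseIndices_eq hn, Finset.sum_insert, Finset.sum_insert, Finset.sum_map]
  · rfl
  · simp
  · simp

theorem card_transverseIndices {n : ℕ} (hn : 3 ≤ n) :
    ((transverseIndices n).card : ℂ) = n - 1 := by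
  rw [Finset.card_eq_sum_ones, sum_transverseIndices hn]
  obtain ⟨k, rfl⟩ : ∃ k, n = 3 + k := ⟨n - 3, by omega⟩
  simp
  ring

/-- The coefficients of `𝒟⁰_N(λ)`. -/
def coeffD0 (n N : ℕ) (lam : ℂ) (j : ℕ) : ℂ :=
  if Even N then (evenCoeff n (N / 2) j).eval lam else (oddCoeff n (N / 2) j).eval lam

/-- Written in `N`, the even and odd recursions become one: each is twice the defining relation at
`j + 1`. The constant `2(n-1) - 4` is what `raising_quadratic` produces for the `n - 1` transverse
coordinates that enter `Δ`. -/
theorem coeffD0_rec (n N : ℕ) (lam : ℂ) {j : ℕ} (hj : j < N / 2) :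
    ((N : ℂ) - 2 * j) * (N - 2 * j - 1) * coeffD0 n N lam j
      + (j + 1) * (4 * lam - 4 * (N - 2 * (j + 1)) - 4 * j + (2 * (n - 1) - 4))
        * coeffD0 n N lam (j + 1) = 0 := by
  rcases Nat.even_or_odd' N with ⟨k, rfl | rfl⟩
  · have hk : 2 * k / 2 = k := by omega
    rw [hk] at hj
    have h := ((evenCoeff_unique n k lam fun j => (evenCoeff n k j).eval lam).2
      fun _ _ => rfl).2 (j + 1) (by omega) (by omega)
    simp only [coeffD0, even_two_mul, if_true, hk]
    push_cast at h ⊢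
    linear_combination 2 * h
  · have hk : (2 * k + 1) / 2 = k := by omega
    rw [hk] at hj
    have h := ((oddCoeff_unique n k lam fun j => (oddCoeff n k j).eval lam).2
      fun _ _ => rfl).2 (j + 1) (by omega) (by omega)
    have hodd : ¬ Even (2 * k + 1) := by simp
    simp only [coeffD0, hodd, if_false, hk]
    push_cast at h ⊢
    linear_combination 2 * h

theorem sgn_mul_sgn (a : ℕ) : sgn a * sgn a = 1 := by
  rw [sgn]
  split_ifs <;> norm_num

/-! ### Singular vectors in a representation of `𝔤_m` -/

section LieRepresentation

variable {V : Type*} [AddCommGroup V] [Module ℂ V] {m : ℕ}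

/-- A representation of the real Lie algebra `𝔤_m` on a complex vector space. -/
structure IsLieRep (ρ : LieG m → Module.End ℂ V) : Prop where
  map_add : ∀ X Y, ρ (X + Y) = ρ X + ρ Y
  map_smul : ∀ (c : ℝ) X, ρ (c • X) = (c : ℂ) • ρ X
  map_lie : ∀ X Y, ρ ⁅X, Y⁆ = ρ X * ρ Y - ρ Y * ρ X

variable {ρ : LieG m → Module.End ℂ V}

namespace IsLieRep

theorem mul_apply (hρ : IsLieRep ρ) (X Y : LieG m) (u : V) :
    ρ X (ρ Y u) = ρ Y (ρ X u) + ρ ⁅X, Y⁆ u := by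
  rw [hρ.map_lie]
  simp

theorem map_zero (hρ : IsLieRep ρ) : ρ 0 = 0 := by
  simpa using hρ.map_smul 0 0

theorem map_neg (hρ : IsLieRep ρ) (X : LieG m) : ρ (-X) = -ρ X := by
  simpa using hρ.map_smul (-1) X

theorem map_sub (hρ : IsLieRep ρ) (X Y : LieG m) : ρ (X - Y) = ρ X - ρ Y := by
  rw [sub_eq_add_neg, hρ.map_add, hρ.map_neg, sub_eq_add_neg]

/-- The action of the element of `𝔫^-` which belongs to the coordinate of index `a`. -/
def lower (ρ : LieG m → Module.End ℂ V) (a : ℕ) : Module.End ℂ V :=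
  ρ (lowering m (stdVec m a))

/-- The action of the quadratic element of the coordinates other than `t₁, x₂` and the last
one. -/
def quad (ρ : LieG m → Module.End ℂ V) : Module.End ℂ V :=
  ∑ a ∈ transverseIndices (m - 1), (sgn a : ℂ) • (lower ρ a * lower ρ a)

theorem commute_lower (hρ : IsLieRep ρ) {a b : ℕ} (hm : 3 ≤ m) (ha : a ≠ 0) (ha3 : a ≠ 3)
    (hb : b ≠ 0) (hb3 : b ≠ 3) : Commute (lower ρ a) (lower ρ b) := by
  refine LinearMap.ext fun u => ?_
  rw [Module.End.mul_apply, Module.End.mul_apply, lower, lower, hρ.mul_apply,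
    lie_lowering_lowering hm (transverse_stdVec hm ha ha3) (transverse_stdVec hm hb hb3),
    hρ.map_zero, LinearMap.zero_apply, add_zero]

theorem raising_lower (hρ : IsLieRep ρ) {c a : ℕ} (hm : 3 ≤ m) (hc : c ≤ m) (hc0 : c ≠ 0)
    (hc3 : c ≠ 3) (ha0 : a ≠ 0) (ha3 : a ≠ 3) (u : V) :
    ρ (raising m (stdVec m c)) (lower ρ a u) = lower ρ a (ρ (raising m (stdVec m c)) u)
        + (2 : ℂ) • ρ (rotation (stdVec m c) (stdVec m a)) u
        + (2 * if c = a then (sgn c : ℂ) else 0) • ρ (H m) u := by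
  rw [lower, hρ.mul_apply, lie_raising_lowering hm (transverse_stdVec hm hc0 hc3)
    (transverse_stdVec hm ha0 ha3), hρ.map_add, LinearMap.add_apply, hρ.map_smul,
    hρ.map_smul, form_stdVec hc, ← add_assoc]
  split_ifs <;> push_cast <;> rfl

theorem rotation_lower (hρ : IsLieRep ρ) {c a b : ℕ} (hm : 3 ≤ m) (hc : c ≤ m) (hc0 : c ≠ 0)
    (hc3 : c ≠ 3) (ha : a ≤ m) (ha0 : a ≠ 0) (ha3 : a ≠ 3) (u : V) :
    ρ (rotation (stdVec m c) (stdVec m a)) (lower ρ b u)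
      = lower ρ b (ρ (rotation (stdVec m c) (stdVec m a)) u)
        + (if a = b then (sgn a : ℂ) else 0) • lower ρ c u
        - (if c = b then (sgn c : ℂ) else 0) • lower ρ a u := by
  rw [lower, hρ.mul_apply, lie_rotation_lowering (transverse_stdVec hm hc0 hc3)
    (transverse_stdVec hm ha0 ha3), hρ.map_sub, LinearMap.sub_apply, hρ.map_smul,
    hρ.map_smul, form_stdVec hc, form_stdVec ha, ← add_sub_assoc]
  split_ifs <;> push_cast <;> rfl

theorem H_lower (hρ : IsLieRep ρ) {a : ℕ} (hm : 3 ≤ m) (ha0 : a ≠ 0) (ha3 : a ≠ 3) (u : V) :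
    ρ (H m) (lower ρ a u) = lower ρ a (ρ (H m) u) - lower ρ a u := by
  rw [lower, hρ.mul_apply, lie_H_lowering hm (transverse_stdVec hm ha0 ha3), hρ.map_neg,
    LinearMap.neg_apply, sub_eq_add_neg]

theorem H_monomial (hρ : IsLieRep ρ) (hm : 4 ≤ m) {u : V} {lam : ℂ}
    (hH : ρ (H m) u = lam • u) (j k : ℕ) :
    ρ (H m) ((quad ρ ^ j * lower ρ m ^ k) u)
      = (lam - 2 * j - k) • (quad ρ ^ j * lower ρ m ^ k) u := by
  refine weight_monomial (fun z => weight_quadratic _ _ _ _ (fun a ha z => ?_) z)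
    (fun z => hρ.H_lower (by omega) (by omega) (by omega) z) hH j k
  obtain ⟨-, h0, h3⟩ := mem_transverseIndices.1 ha
  exact hρ.H_lower (by omega) h0 h3 z

/-- If `u` is annihilated by `𝔪_m` and `𝔫_m^+` and of weight `λ`, then `𝒟⁰_N(λ) u` is annihilated
by `𝔫_{m-1}^+`. -/
theorem raising_sum (hρ : IsLieRep ρ) {n : ℕ} (hn : n + 1 = m) (hn3 : 3 ≤ n) {u : V} {lam : ℂ}
    (hH : ρ (H m) u = lam • u) (hm : ∀ Z ∈ mAlg m, ρ Z u = 0) (hp : ∀ X ∈ nPlus m, ρ X u = 0)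
    (N : ℕ) {c : ℕ} (hc : c ∈ transverseIndices n) :
    ρ (raising m (stdVec m c)) ((∑ j ∈ Finset.range (N / 2 + 1),
      coeffD0 n N lam j • (quad ρ ^ j * lower ρ m ^ (N - 2 * j))) u) = 0 := by
  obtain ⟨hcn, hc0, hc3⟩ := mem_transverseIndices.1 hc
  have h3 : 3 ≤ m := by omega
  have hquad : quad ρ = ∑ a ∈ transverseIndices n, (sgn a : ℂ) • (lower ρ a * lower ρ a) := by
    rw [quad, show m - 1 = n by omega]
  have hsgn : ∀ a, (sgn a : ℂ) * sgn a = 1 := fun a => by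
    rw [← Complex.ofReal_mul, sgn_mul_sgn, Complex.ofReal_one]
  have hrot : ∀ a ≤ m, a ≠ 0 → a ≠ 3 → ρ (rotation (stdVec m c) (stdVec m a)) u = 0 :=
    fun a ha ha0 ha3 => hm _ (rotation_mem_mAlg (by omega) ha hc0 hc3 ha0 ha3)
  -- Rotations among the coordinates `a ≤ n` commute with both `Δ` and `T`, so they still annihilate
  -- every `Δ^j T^k u`. The rotation of `c` towards the last coordinate does not commute with `T`;
  -- it plays the role of `r` in `raising_pow`.
  have hcD : ∀ a ∈ transverseIndices n,
      Commute (ρ (rotation (stdVec m c) (stdVec m a))) (quad ρ) := by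
    intro a ha
    obtain ⟨han, ha0, ha3⟩ := mem_transverseIndices.1 ha
    rw [hquad]
    refine commute_rotation_quadratic _ hc ha _ hsgn _ _ fun b _ => LinearMap.ext fun z => ?_
    exact hρ.rotation_lower h3 (by omega) hc0 hc3 (by omega) ha0 ha3 z
  have hcT : ∀ a ∈ transverseIndices n,
      Commute (ρ (rotation (stdVec m c) (stdVec m a))) (lower ρ m) := by
    intro a ha
    obtain ⟨han, ha0, ha3⟩ := mem_transverseIndices.1 ha
    refine LinearMap.ext fun z => ?_
    rw [Module.End.mul_apply, Module.End.mul_apply,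
      hρ.rotation_lower h3 (by omega) hc0 hc3 (by omega) ha0 ha3, if_neg (by omega),
      if_neg (by omega), zero_smul, zero_smul, add_zero, sub_zero]
  refine raising_sum_eq_zero (y := lower ρ c) (lam := lam) (κ := 2 * (n - 1) - 4) N ?_ _
    fun j hj => coeffD0_rec n N lam hj
  refine raising_pow (r := ρ (rotation (stdVec m c) (stdVec m m)))
    ?_ ?_ ?_ ?_ (hrot _ le_rfl (by omega) (by omega)) ?_ ?_
  · rw [hquad]
    refine Commute.sum_right _ _ _ fun a ha => ?_
    obtain ⟨han, ha0, ha3⟩ := mem_transverseIndices.1 ha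
    have h := hρ.commute_lower h3 hc0 hc3 ha0 ha3
    exact (h.mul_right h).smul_right _
  · exact hρ.commute_lower h3 hc0 hc3 (by omega) (by omega)
  · intro z
    rw [hρ.raising_lower h3 (by omega) hc0 hc3 (by omega) (by omega), if_neg (by omega),
      mul_zero, zero_smul, add_zero]
  · intro z
    rw [hρ.rotation_lower h3 (by omega) hc0 hc3 le_rfl (by omega) (by omega), if_pos rfl,
      if_neg (by omega), zero_smul, sub_zero, sgn, if_neg (by omega), Complex.ofReal_one, one_smul]
  · exact hp _ (lie_H_raising h3 (transverse_stdVec h3 hc0 hc3))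
  · intro j k
    have hw : ∀ a ∈ transverseIndices n, ρ (rotation (stdVec m c) (stdVec m a))
          ((quad ρ ^ j * lower ρ m ^ k) u) = 0 := by
      intro a ha
      obtain ⟨han, ha0, ha3⟩ := mem_transverseIndices.1 ha
      rw [← Module.End.mul_apply,
        (((hcD a ha).pow_right j).mul_right ((hcT a ha).pow_right k)).eq, Module.End.mul_apply,
        hrot a (by omega) ha0 ha3, _root_.map_zero]
    have h := raising_quadratic (transverseIndices n) hc (fun a => (sgn a : ℂ)) hsgn
      (fun a => lower ρ a) (fun a => ρ (rotation (stdVec m c) (stdVec m a)))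
      (ρ (raising m (stdVec m c))) (ρ (H m))
      (fun a ha z => by
        obtain ⟨han, ha0, ha3⟩ := mem_transverseIndices.1 ha
        exact hρ.raising_lower h3 (by omega) hc0 hc3 ha0 ha3 z)
      (fun a ha z => by
        obtain ⟨han, ha0, ha3⟩ := mem_transverseIndices.1 ha
        have := hρ.rotation_lower (b := a) h3 (by omega : c ≤ m) hc0 hc3 (by omega) ha0 ha3 z
        rwa [if_pos rfl] at this)
      (fun z => hρ.H_lower h3 hc0 hc3 z) hw (hρ.H_monomial (by omega) hH j k)
    have hL : ∀ z, quad ρ z = ∑ a ∈ transverseIndices n,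
        (sgn a : ℂ) • lower ρ a (lower ρ a z) := fun z => by
      rw [hquad]
      simp
    rw [hL, h, ← hL, card_transverseIndices hn3]
    congr 2
    ring

/-- `𝒟⁰_N(λ) u` is annihilated by the elements of `𝔫_m^+` without component in the direction of
the last coordinate. -/
theorem nPlus_sum (hρ : IsLieRep ρ) {n : ℕ} (hn : n + 1 = m) (hn3 : 3 ≤ n) {u : V} {lam : ℂ}
    (hH : ρ (H m) u = lam • u) (hm : ∀ Z ∈ mAlg m, ρ Z u = 0) (hp : ∀ X ∈ nPlus m, ρ X u = 0)
    (N : ℕ) {X : LieG m} (hX : X ∈ nPlus m)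
    (hlast : (X : Mat m) (Fin.last m) 0 = 0) :
    ρ X ((∑ j ∈ Finset.range (N / 2 + 1),
      coeffD0 n N lam j • (quad ρ ^ j * lower ρ m ^ (N - 2 * j))) u) = 0 := by
  -- `ρ` is a bare function; the additive bundling makes finite sums available, and real scalars are
  -- handled by `hρ.map_smul`.
  let f : LieG m →+ Module.End ℂ V := AddMonoidHom.mk' ρ hρ.map_add
  have hf : ∀ Y, ρ Y = f Y := fun _ => rfl
  obtain ⟨hraise, h0, h3⟩ := nPlus_eq_raising (by omega) hX
  rw [hraise, pi_eq_sum_univ' (fun i => (X : Mat m) i 0), hf,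
    _root_.map_sum, _root_.map_sum, LinearMap.sum_apply]
  refine Finset.sum_eq_zero fun i _ => ?_
  have hi : Pi.single (M := fun _ => ℝ) i 1 = stdVec m i := (stdVec_val i).symm
  rw [hi, _root_.map_smul, ← hf, hρ.map_smul, LinearMap.smul_apply]
  -- The remaining indices are `0`, `3` and `m`; there the first column of `X` vanishes, by the
  -- shape of `𝔫^+` for the first two and by `hlast` for the third.
  by_cases hi' : i.val ∈ transverseIndices n
  · rw [hρ.raising_sum hn hn3 hH hm hp N hi', smul_zero]
  · have hz : (X : Mat m) i 0 = 0 := by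
      by_cases h1 : i.val = 0
      · rwa [show i = 0 from Fin.ext (by simpa using h1)]
      by_cases h2 : i.val = 3
      · rwa [show i = ⟨3, by omega⟩ from Fin.ext h2]
      have h4 : i.val = m := by
        have := i.2
        simp only [mem_transverseIndices] at hi'
        omega
      rwa [show i = Fin.last m from Fin.ext h4]
    rw [hz, Complex.ofReal_zero, zero_smul]

end IsLieRep

end LieRepresentation

/-! ### The family in the right regular representation -/

theorem isLieRep_rightRep (m : ℕ) : IsLieRep (rightRep m) where
  map_add X Y := map_add _ X Y
  map_smul c X := map_smul (rightRep m) c X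
  map_lie X Y := by rw [LieHom.map_lie, LieRing.of_associative_ring_bracket]

/-- The index `3 + (n - 2)` is `n + 1`, so `T_n` is the lowering element of the last coordinate of
`G^{n+1}`. -/
theorem R_T {n : ℕ} (hn : 3 ≤ n) :
    R (n + 1) (T n) = IsLieRep.lower (rightRep (n + 1)) (n + 1) := by
  have h : Yminus (n + 1) (n - 2) = lowering (n + 1) (stdVec (n + 1) (n + 1)) := by
    rw [Yminus_eq]
    congr 2
    omega
  rw [T, R_toUG_eq, h, IsLieRep.lower]

/-- The right side carries the signs as scalars and is bracketed as in `sum_transverseIndices`, so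
that it can be matched with `IsLieRep.quad`. -/
theorem map_quadratic {A B ι : Type*} [Ring A] [Ring B] [Algebra ℂ A] [Algebra ℂ B]
    (f : A →ₐ[ℂ] B) (s : Finset ι) {x y : A} {z : ι → A} {p q : B} {r : ι → B} (hx : f x = p) (hy : f y = q)
    (hz : ∀ j, f (z j) = r j) : f (-x ^ 2 + y ^ 2 + ∑ j ∈ s, z j ^ 2)
      = (-1 : ℂ) • (p * p) + ((1 : ℂ) • (q * q) + ∑ j ∈ s, (1 : ℂ) • (r j * r j)) := by
  simp [← hx, ← hy, ← hz, pow_two, add_assoc]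

theorem R_Lap {n : ℕ} (hn : 3 ≤ n) : R (n + 1) (Lap n) = IsLieRep.quad (rightRep (n + 1)) := by
  have hl : ∀ a, R (n + 1) (toUG (lowering (n + 1) (stdVec (n + 1) a)))
      = IsLieRep.lower (rightRep (n + 1)) a := fun a => R_toUG_eq _
  have hQ1 := hl 1
  have hQ2 := hl 2
  rw [← Q1minus_eq] at hQ1
  rw [← Q2minus_eq] at hQ2
  have hY : ∀ j, R (n + 1) (toUG (Yminus (n + 1) j))
      = IsLieRep.lower (rightRep (n + 1)) (3 + j) := fun j => by
    rw [Yminus_eq]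
    exact hl (3 + j)
  refine (map_quadratic (A := UG (n + 1)) (B := Module.End ℂ (Smooth (n + 1))) (R (n + 1))
    (Finset.Icc 1 (n - 3)) (z := fun j => toUG (Yminus (n + 1) j))
    (r := fun j => IsLieRep.lower (rightRep (n + 1)) (3 + j)) hQ1 hQ2 hY).trans ?_
  refine Eq.trans ?_ (sum_transverseIndices hn _).symm
  simp [sgn, show ∀ k, ¬ 3 + k < 2 by omega]

theorem R_D0 {n : ℕ} (hn : 3 ≤ n) (N : ℕ) (lam : ℂ) : R (n + 1) (D0 n N lam) =
    ∑ j ∈ Finset.range (N / 2 + 1), coeffD0 n N lam j •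
      (IsLieRep.quad (rightRep (n + 1)) ^ j
        * IsLieRep.lower (rightRep (n + 1)) (n + 1) ^ (N - 2 * j)) := by
  rw [← R_Lap hn, ← R_T hn, D0]
  split_ifs with h <;> simp [coeffD0, h]

theorem H_R_D0 {n : ℕ} (hn : 3 ≤ n) {u : Smooth (n + 1)} {lam : ℂ}
    (hH : rightRep (n + 1) (H (n + 1)) u = lam • u) (N : ℕ) (mu : ℂ) :
    rightRep (n + 1) (H (n + 1)) (R (n + 1) (D0 n N mu) u)
      = (lam - N) • R (n + 1) (D0 n N mu) u := by
  rw [R_D0 hn]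
  exact weight_sum ((isLieRep_rightRep (n + 1)).H_monomial (by omega) hH) N _

/-! ### The inclusion of `𝔤_n` in `𝔤_{n+1}` and the exponential map -/

/-- The block matrix with the blocks `A` and `0`. -/
def blockZero (n : ℕ) : Mat n →ₗ[ℝ] Mat (n + 1) where
  toFun A := Matrix.reindex finSumFinEquiv finSumFinEquiv
    (Matrix.fromBlocks A 0 0 (0 : Matrix (Fin 1) (Fin 1) ℝ))
  map_add' A B := by
    ext i j
    simp only [Matrix.reindex_apply, Matrix.add_apply, Matrix.submatrix_apply]
    generalize finSumFinEquiv.symm i = a, finSumFinEquiv.symm j = b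
    rcases a with a | a <;> rcases b with b | b <;> simp
  map_smul' c A := by
    ext i j
    simp only [Matrix.reindex_apply, Matrix.smul_apply, Matrix.submatrix_apply, RingHom.id_apply]
    generalize finSumFinEquiv.symm i = a, finSumFinEquiv.symm j = b
    rcases a with a | a <;> rcases b with b | b <;> simp

theorem blockZero_apply {n : ℕ} (A : Mat n) : blockZero n A =
    Matrix.reindex finSumFinEquiv finSumFinEquiv
      (Matrix.fromBlocks A 0 0 (0 : Matrix (Fin 1) (Fin 1) ℝ)) := rfl

theorem blockZero_mul {n : ℕ} (A B : Mat n) :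
    blockZero n (A * B) = blockZero n A * blockZero n B := by
  simp [blockZero_apply, Matrix.submatrix_mul_equiv, Matrix.fromBlocks_multiply]

theorem blockZero_mul_blockOne {n : ℕ} (A B : Mat n) :
    blockZero n (A * B) = blockZero n A * blockOne B := by
  simp [blockZero_apply, blockOne, Matrix.submatrix_mul_equiv, Matrix.fromBlocks_multiply]

theorem blockOne_mul_blockZero {n : ℕ} (A B : Mat n) :
    blockZero n (A * B) = blockOne A * blockZero n B := by
  simp [blockZero_apply, blockOne, Matrix.submatrix_mul_equiv, Matrix.fromBlocks_multiply]

theorem blockZero_transpose {n : ℕ} (A : Mat n) : blockZero n Aᵀ = (blockZero n A)ᵀ := by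
  simp [blockZero_apply, Matrix.fromBlocks_transpose]

theorem blockOne_transpose {n : ℕ} (A : Mat n) : blockOne Aᵀ = (blockOne A)ᵀ := by
  simp [blockOne, Matrix.fromBlocks_transpose]

theorem blockOne_eq {n : ℕ} (A : Mat n) : blockOne A = blockZero n A + blockOne 0 := by
  ext i j
  simp only [blockOne, blockZero_apply, Matrix.reindex_apply, Matrix.add_apply,
    Matrix.submatrix_apply]
  generalize finSumFinEquiv.symm i = a, finSumFinEquiv.symm j = b
  rcases a with a | a <;> rcases b with b | b <;> simp

/-- `blockZero` is multiplicative but not unital, so the exponent zero is excluded. -/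
theorem blockZero_pow_succ {n : ℕ} (A : Mat n) (k : ℕ) :
    blockZero n (A ^ (k + 1)) = blockZero n A ^ (k + 1) := by
  induction k with
  | zero => simp
  | succ k ih => rw [pow_succ, blockZero_mul, ih, ← pow_succ]

section

attribute [local instance] Matrix.linftyOpNormedRing Matrix.linftyOpNormedAlgebra

/-- The exponential series correspond term by term except in degree zero, where the identity has the
extra corner entry `blockOne 0`; this turns the block `0` into the block `1`. -/
theorem exp_blockZero {n : ℕ} (A : Mat n) :
    NormedSpace.exp (blockZero n A) = blockOne (NormedSpace.exp A) := by
  have h1 : HasSum (fun k : ℕ => blockZero n ((k.factorial⁻¹ : ℝ) • A ^ k))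
      (blockZero n (NormedSpace.exp A)) :=
    (NormedSpace.exp_series_hasSum_exp' (𝕂 := ℝ) A).mapL (LinearMap.toContinuousLinearMap (blockZero n))
  have h2 : HasSum (fun k : ℕ => if k = 0 then (blockOne 0 : Mat (n + 1)) else 0) (blockOne 0) :=
    hasSum_ite_eq 0 _
  have h3 := h1.add h2
  rw [← blockOne_eq] at h3
  have h4 := NormedSpace.exp_series_hasSum_exp' (𝕂 := ℝ) (blockZero n A)
  have h5 : (fun k : ℕ => (k.factorial⁻¹ : ℝ) • blockZero n A ^ k) = fun k : ℕ =>
      blockZero n ((k.factorial⁻¹ : ℝ) • A ^ k) + if k = 0 then (blockOne 0 : Mat (n + 1)) else 0 := by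
    funext k
    rcases k with _ | k
    · simp [← blockOne_eq, blockOne_one]
    · rw [if_neg (by omega), add_zero, map_smul, blockZero_pow_succ]
  rw [h5] at h4
  exact h4.unique h3

end

theorem blockZero_castSucc {n : ℕ} (A : Mat n) (i j : Fin (n + 1)) :
    blockZero n A i.castSucc j.castSucc = A i j := by
  have h : ∀ i : Fin (n + 1), finSumFinEquiv.symm (i.castSucc) = (Sum.inl i : _ ⊕ Fin 1) := fun i =>
    finSumFinEquiv_symm_apply_castAdd i
  simp [blockZero_apply, h]

theorem blockZero_last_left {n : ℕ} (A : Mat n) (j : Fin (n + 2)) :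
    blockZero n A (Fin.last _) j = 0 := by
  have h : finSumFinEquiv.symm (Fin.last (n + 1)) = (Sum.inr 0 : Fin (n + 1) ⊕ _) :=
    finSumFinEquiv_symm_apply_natAdd 0
  simp only [blockZero_apply, Matrix.reindex_apply, Matrix.submatrix_apply, h]
  generalize (finSumFinEquiv (m := n + 1) (n := 1)).symm j = b
  rcases b with b | b <;> rfl

theorem blockZero_last_right {n : ℕ} (A : Mat n) (i : Fin (n + 2)) :
    blockZero n A i (Fin.last _) = 0 := by
  have h := blockZero_last_left Aᵀ i
  rwa [blockZero_transpose] at h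

theorem blockOne_castSucc {n : ℕ} (A : Mat n) (i j : Fin (n + 1)) :
    blockOne A i.castSucc j.castSucc = A i j := by
  have h : ∀ i : Fin (n + 1), finSumFinEquiv.symm (i.castSucc) = (Sum.inl i : _ ⊕ Fin 1) := fun i =>
    finSumFinEquiv_symm_apply_castAdd i
  simp [blockOne, h]

theorem blockOne_last_left {n : ℕ} (A : Mat n) (j : Fin (n + 2)) :
    blockOne A (Fin.last _) j = if j = Fin.last _ then 1 else 0 := by
  have h : finSumFinEquiv.symm (Fin.last (n + 1)) = (Sum.inr 0 : Fin (n + 1) ⊕ _) :=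
    finSumFinEquiv_symm_apply_natAdd 0
  refine Fin.lastCases ?_ (fun j => ?_) j
  · simp [blockOne, h]
  · have h' : finSumFinEquiv.symm (j.castSucc) = (Sum.inl j : _ ⊕ Fin 1) :=
      finSumFinEquiv_symm_apply_castAdd j
    rw [if_neg (Fin.castSucc_lt_last j).ne]
    simp [blockOne, h, h']

theorem blockOne_last_right {n : ℕ} (A : Mat n) (i : Fin (n + 2)) :
    blockOne A i (Fin.last _) = if i = Fin.last _ then 1 else 0 := by
  have h := blockOne_last_left Aᵀ i
  rwa [blockOne_transpose] at h

theorem blockZero_E {n a b : ℕ} (ha : a ≤ n) (hb : b ≤ n) :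
    blockZero n (E n a b) = E (n + 1) a b := by
  ext i j
  refine Fin.lastCases ?_ (fun i => ?_) i
  · rw [blockZero_last_left, E, Matrix.of_apply, if_neg (by simp; omega)]
  · refine Fin.lastCases ?_ (fun j => ?_) j
    · rw [blockZero_last_right, E, Matrix.of_apply, if_neg (by simp; omega)]
    · rw [blockZero_castSucc]
      simp [E]

theorem blockOne_mulVec_stdVec {n a : ℕ} (A : Mat n) (ha : a ≤ n) {c : ℝ}
    (h : A *ᵥ stdVec n a = c • stdVec n a) :
    blockOne A *ᵥ stdVec (n + 1) a = c • stdVec (n + 1) a := by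
  have hcol : ∀ i : Fin (n + 2), (blockOne A *ᵥ stdVec (n + 1) a) i
      = blockOne A i (Fin.castSucc ⟨a, by omega⟩) := fun i => by
    rw [Matrix.mulVec, dotProduct_comm, stdVec_dotProduct (by omega)]
    rfl
  ext i
  rw [hcol]
  refine Fin.lastCases ?_ (fun i => ?_) i
  · rw [blockOne_last_left, if_neg (Fin.castSucc_lt_last _).ne, Pi.smul_apply, stdVec,
      if_neg (by simp; omega), smul_zero]
  · have h1 := congrFun h i
    rw [Matrix.mulVec, dotProduct_comm, stdVec_dotProduct ha] at h1
    rw [blockOne_castSucc, h1]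
    simp [stdVec]

theorem blockOne_mulVec_last {n : ℕ} (A : Mat n) :
    blockOne A *ᵥ stdVec (n + 1) (n + 1) = stdVec (n + 1) (n + 1) := by
  ext i
  rw [Matrix.mulVec, dotProduct_comm, stdVec_dotProduct le_rfl]
  refine (blockOne_last_right A i).trans ?_
  simp [stdVec, Fin.ext_iff]

theorem eta_succ_eq_blockOne {n : ℕ} (hn : 1 ≤ n) : eta (n + 1) = blockOne (eta n) := by
  ext i j
  refine Fin.lastCases ?_ (fun i => ?_) i
  · rw [blockOne_last_left, eta, Matrix.diagonal_apply]
    simp [eq_comm, show n ≠ 0 by omega]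
  · refine Fin.lastCases ?_ (fun j => ?_) j
    · rw [blockOne_last_right, eta, Matrix.diagonal_apply, if_neg (Fin.castSucc_lt_last _).ne,
        if_neg (Fin.castSucc_lt_last _).ne]
    · rw [blockOne_castSucc, eta, eta, Matrix.diagonal_apply, Matrix.diagonal_apply]
      simp

/-- The inclusion `𝔤_n → 𝔤_{n+1}`. -/
def inclLie {n : ℕ} (hn : 1 ≤ n) : LieG n →ₗ[ℝ] LieG (n + 1) where
  toFun X := ⟨blockZero n X, by
    rw [mem_LieG, eta_succ_eq_blockOne hn, ← blockZero_transpose, ← blockZero_mul_blockOne, ← map_neg,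
      ← blockOne_mul_blockZero, mem_LieG.1 X.2]⟩
  map_add' X Y := Subtype.ext (map_add _ _ _)
  map_smul' c X := Subtype.ext (map_smul _ _ _)

theorem coe_inclLie {n : ℕ} (hn : 1 ≤ n) (X : LieG n) :
    (inclLie hn X : Mat (n + 1)) = blockZero n X := rfl

theorem incl_expG {n : ℕ} (hn : 1 ≤ n) (X : LieG n) : incl n (expG X) = expG (inclLie hn X) :=
  toMat_injective (exp_blockZero _).symm

theorem inclLie_H {n : ℕ} (hn : 3 ≤ n) : inclLie (by omega) (H n) = H (n + 1) := by
  refine Subtype.ext ?_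
  rw [coe_inclLie, H, H, map_add, blockZero_E (by omega) hn, blockZero_E hn (by omega)]

theorem inclLie_mem_nPlus {n : ℕ} (hn : 3 ≤ n) {X : LieG n} (hX : X ∈ nPlus n) :
    inclLie (by omega) X ∈ nPlus (n + 1) := by
  have h : (H n : Mat n) * (X : Mat n) - (X : Mat n) * (H n : Mat n) = X :=
    congrArg Subtype.val (hX : ⁅H n, X⁆ = X)
  refine Subtype.ext ?_
  change (H (n + 1) : Mat (n + 1)) * (blockZero n X) - (blockZero n X) * (H (n + 1) : Mat (n + 1))
    = blockZero n X
  rw [← inclLie_H hn, coe_inclLie, ← blockZero_mul, ← blockZero_mul, ← map_sub, h]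

theorem inclLie_mem_mAlg {n : ℕ} (hn : 3 ≤ n) {X : LieG n} (hX : X ∈ mAlg n) :
    inclLie (by omega) X ∈ mAlg (n + 1) := by
  suffices h : mAlg n ≤ (mAlg (n + 1)).comap (inclLie (by omega)) from h hX
  refine Submodule.span_le.2 ?_
  rintro _ ((⟨i, j, hi, hi', hj, hj', rfl⟩ | ⟨j, hj, hj', rfl | rfl⟩) | rfl)
  · refine Submodule.subset_span (Or.inl (Or.inl ⟨i, j, hi, by omega, hj, by omega, ?_⟩))
    refine Subtype.ext ?_
    simp only [coe_inclLie, Mrot, map_sub, blockZero_E (show 3 + i ≤ n by omega) (show 3 + j ≤ n by omega),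
      blockZero_E (show 3 + j ≤ n by omega) (show 3 + i ≤ n by omega)]
  · refine Submodule.subset_span (Or.inl (Or.inr ⟨j, hj, by omega, Or.inl ?_⟩))
    refine Subtype.ext ?_
    have h1 : 1 ≤ n := by omega
    have h2 : 2 ≤ n := by omega
    have h3 : 3 + j ≤ n := by omega
    simp only [coe_inclLie, Zplus, map_sub, map_add, blockZero_E h1 h3, blockZero_E h3 h1,
      blockZero_E h2 h3, blockZero_E h3 h2]
  · refine Submodule.subset_span (Or.inl (Or.inr ⟨j, hj, by omega, Or.inr ?_⟩))
    refine Subtype.ext ?_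
    have h1 : 1 ≤ n := by omega
    have h2 : 2 ≤ n := by omega
    have h3 : 3 + j ≤ n := by omega
    simp only [coe_inclLie, Zminus, map_sub, map_add, blockZero_E h1 h3, blockZero_E h3 h1,
      blockZero_E h2 h3, blockZero_E h3 h2]
  · refine Submodule.subset_span (Or.inr (Subtype.ext ?_))
    have h1 : 1 ≤ n := by omega
    have h2 : 2 ≤ n := by omega
    simp only [coe_inclLie, H2, map_add, blockZero_E h1 h2, blockZero_E h2 h1]

/-! ### The groups `M_0`, `M`, `M̂` under the inclusion -/

theorem M0_le_comap {n : ℕ} (hn : 3 ≤ n) : M0 n ≤ (M0 (n + 1)).comap (incl n) := by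
  refine (Subgroup.closure_le _).2 ?_
  rintro _ ⟨X, hX, rfl⟩
  refine Subgroup.subset_closure ⟨_, inclLie_mem_mAlg hn hX, ?_⟩
  exact (incl_expG (by omega) X).symm

theorem MGroup_le_comap {n : ℕ} (hn : 3 ≤ n) : MGroup n ≤ (MGroup (n + 1)).comap (incl n) := by
  refine sup_le ?_ ((M0_le_comap hn).trans (Subgroup.comap_mono le_sup_right))
  rintro k ⟨hk, hk'⟩
  refine Subgroup.mem_sup_left ⟨?_, ?_⟩
  · have h : (toMat k)ᵀ * toMat k = 1 := hk
    change (blockOne (toMat k))ᵀ * blockOne (toMat k) = 1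
    rw [← blockOne_transpose, ← blockOne_mul, h, blockOne_one]
  · rw [toMat_incl, ← inclLie_H hn, coe_inclLie, ← blockOne_mul_blockZero,
      ← blockZero_mul_blockOne, hk']

theorem incl_signFlip {n a : ℕ} (ha : a ≤ n) : incl n (signFlip n a) = signFlip (n + 1) a := by
  refine toMat_injective (Matrix.ext fun i j => ?_)
  rw [toMat_incl, signFlip, signFlip, toMat_mkG, toMat_mkG]
  refine Fin.lastCases ?_ (fun i => ?_) i
  · rw [blockOne_last_left, Matrix.diagonal_apply, Fin.val_last, if_neg (by omega : n + 1 ≠ a)]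
    simp only [eq_comm]
  · refine Fin.lastCases ?_ (fun j => ?_) j
    · rw [blockOne_last_right, Matrix.diagonal_apply, if_neg (Fin.castSucc_lt_last _).ne,
        if_neg (Fin.castSucc_lt_last _).ne]
    · rw [blockOne_castSucc, Matrix.diagonal_apply, Matrix.diagonal_apply]
      simp

theorem MHat_le_comap {n : ℕ} (hn : 3 ≤ n) : MHat n ≤ (MHat (n + 1)).comap (incl n) := by
  refine sup_le ?_ ((M0_le_comap hn).trans (Subgroup.comap_mono le_sup_right))
  refine (Subgroup.closure_le _).2 ?_
  rintro _ (rfl | rfl)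
  · refine Subgroup.mem_sup_left (Subgroup.subset_closure (Or.inl ?_))
    exact incl_signFlip (by omega)
  · refine Subgroup.mem_sup_left (Subgroup.subset_closure (Or.inr ?_))
    exact incl_signFlip (by omega)

theorem signFlip_mem_ZKa {m a : ℕ} (h0 : a ≠ 0) (h3 : a ≠ 3) : signFlip m a ∈ ZKa m := by
  refine ⟨?_, ?_⟩
  · change (toMat (signFlip m a))ᵀ * toMat (signFlip m a) = 1
    rw [signFlip, toMat_mkG, Matrix.diagonal_transpose, Matrix.diagonal_mul_diagonal,
      ← Matrix.diagonal_one]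
    congr 1
    funext i
    split_ifs <;> norm_num
  · ext i j
    rw [signFlip, toMat_mkG, Matrix.diagonal_mul, Matrix.mul_diagonal]
    simp only [H, Matrix.add_apply, E, Matrix.of_apply]
    by_cases hi : i.val = a
    · simp [hi, h0, h3]
    · by_cases hj : j.val = a
      · simp [hj, h0, h3]
      · simp [hi, hj]

theorem MHat_le_MGroup (m : ℕ) : MHat m ≤ MGroup m := by
  refine sup_le ?_ le_sup_right
  refine (Subgroup.closure_le _).2 ?_
  rintro _ (rfl | rfl)
  · exact Subgroup.mem_sup_left (signFlip_mem_ZKa (by omega) (by omega))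
  · exact Subgroup.mem_sup_left (signFlip_mem_ZKa (by omega) (by omega))

/-! ### The sign by which `M` acts on the plane of `t₁, x₂` -/

theorem mAlg_commute_H {m : ℕ} {X : LieG m} (hX : X ∈ mAlg m) :
    Commute (X : Mat m) (H m : Mat m) := by
  have h0 : ∀ k, 3 + k ≠ 0 := by omega
  induction hX using Submodule.span_induction with
  | mem x h =>
    rcases h with (⟨a, b, ha, -, hb, -, rfl⟩ | ⟨a, ha, -, rfl | rfl⟩) | rfl
    · have h1 : a ≠ 0 := by omega
      have h2 : b ≠ 0 := by omega
      simp [commute_iff_eq, Mrot, H, mul_add, add_mul, mul_sub, sub_mul, E_mul_E_of_ne,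
        (h0 _).symm, h1, h2]
    · have h1 : a ≠ 0 := by omega
      simp [commute_iff_eq, Zplus, H, mul_add, add_mul, mul_sub, sub_mul, E_mul_E_of_ne,
        (h0 _).symm, h1]
    · have h1 : a ≠ 0 := by omega
      simp [commute_iff_eq, Zminus, H, mul_add, add_mul, mul_sub, sub_mul, E_mul_E_of_ne,
        (h0 _).symm, h1]
    · simp [commute_iff_eq, H2, H, mul_add, add_mul, E_mul_E_of_ne]
  | zero => exact Commute.zero_left _
  | add x y _ _ hx hy => exact hx.add_left hy
  | smul c x _ hx => exact hx.smul_left c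

section

attribute [local instance] Matrix.linftyOpNormedRing Matrix.linftyOpNormedAlgebra

theorem commute_expG {m : ℕ} {X : LieG m} {A : Mat m} (h : Commute (X : Mat m) A) :
    Commute (toMat (expG X)) A := h.exp_left

theorem semiconj_expG {m : ℕ} {p : G m} {X X' : LieG m}
    (h : toMat p * (X : Mat m) = (X' : Mat m) * toMat p) : p * expG X = expG X' * p := by
  have h1 : SemiconjBy (toMat p) (X : Mat m) (X' : Mat m) := h
  exact toMat_injective h1.exp_right

theorem expG_add_smul {m : ℕ} (X : LieG m) (s t : ℝ) :
    expG ((s + t) • X) = expG (s • X) * expG (t • X) := by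
  refine toMat_injective ?_
  rw [toMat_mul, toMat_expG, toMat_expG, toMat_expG, add_smul]
  exact NormedSpace.exp_add_of_commute (((Commute.refl (X : Mat m)).smul_left s).smul_right t)

end

theorem MGroup_commute_H {m : ℕ} {l : G m} (hl : l ∈ MGroup m) :
    Commute (toMat l) (H m : Mat m) := by
  let S : Subgroup (G m) :=
    { carrier := {g | Commute (toMat g) (H m : Mat m)}
      mul_mem' := fun ha hb => Commute.mul_left ha hb
      one_mem' := Commute.one_left _
      inv_mem' := by
        intro g hg
        have h1 : toMat g * toMat g⁻¹ = 1 := by rw [← toMat_mul, mul_inv_cancel, toMat_one]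
        have h2 : toMat g⁻¹ * toMat g = 1 := by rw [← toMat_mul, inv_mul_cancel, toMat_one]
        exact Commute.units_inv_left (u := ⟨toMat g, toMat g⁻¹, h1, h2⟩) hg }
  suffices h : MGroup m ≤ S from h hl
  refine sup_le (fun k hk => hk.2) ((Subgroup.closure_le _).2 ?_)
  rintro _ ⟨X, hX, rfl⟩
  exact commute_expG (mAlg_commute_H hX)

theorem MGroup_mulVec_zero {m : ℕ} (hm : 3 ≤ m) {l : G m} (hl : l ∈ MGroup m) :
    toMat l *ᵥ stdVec m 0 = toMat l 0 0 • stdVec m 0 := by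
  ext i
  rw [Matrix.mulVec, dotProduct_comm, stdVec_dotProduct (Nat.zero_le m)]
  by_cases hi : i = 0
  · subst hi
    simp [stdVec]
  · have h : i.val ≠ 0 := fun h => hi (Fin.ext h)
    simp only [Pi.smul_apply, stdVec, h, if_false, smul_zero]
    exact (MGroup_le_stabFirst hm hl i hi).1

theorem H_mulVec_zero {m : ℕ} : (H m : Mat m) *ᵥ stdVec m 0 = stdVec m 3 := by
  change (E m 0 3 + E m 3 0) *ᵥ stdVec m 0 = stdVec m 3
  rw [E_eq_vecMulVec, E_eq_vecMulVec, Matrix.add_mulVec, Matrix.vecMulVec_mulVec,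
    Matrix.vecMulVec_mulVec]
  simp [dotProduct_comm (stdVec m 3), stdVec_dotProduct_stdVec (Nat.zero_le m)]

/-- `H` maps the basis vector of `t₁` to that of `x₂` and commutes with `l`, so `l` acts on both by
the same scalar. -/
theorem MGroup_mulVec_three {m : ℕ} (hm : 3 ≤ m) {l : G m} (hl : l ∈ MGroup m) :
    toMat l *ᵥ stdVec m 3 = toMat l 0 0 • stdVec m 3 := by
  rw [← H_mulVec_zero, Matrix.mulVec_mulVec, (MGroup_commute_H hl).eq, ← Matrix.mulVec_mulVec,
    MGroup_mulVec_zero hm hl, Matrix.mulVec_smul]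

/-- The scalar is a sign because `l` preserves the nonzero value of the form on the basis vector of
`t₁`. -/
theorem MGroup_sq {m : ℕ} (hm : 3 ≤ m) {l : G m} (hl : l ∈ MGroup m) :
    toMat l 0 0 * toMat l 0 0 = 1 := by
  have h := form_stdVec (Nat.zero_le m) 0
  have h2 : form (toMat l *ᵥ stdVec m 0) (toMat l *ᵥ stdVec m 0)
      = form (stdVec m 0) (stdVec m 0) := by
    rw [form, form, Matrix.mulVec_mulVec, Matrix.dotProduct_mulVec, ← Matrix.mulVec_transpose,
      Matrix.mulVec_mulVec, Matrix.transpose_mul, eta_transpose, toMat_mem, dotProduct_comm]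
  rw [MGroup_mulVec_zero hm hl, form, Matrix.mulVec_smul, dotProduct_smul, smul_dotProduct, ← form,
    h] at h2
  simp [sgn] at h2
  linarith

theorem mul_eta_mul_transpose {m : ℕ} (p : G m) : toMat p * eta m * (toMat p)ᵀ = eta m := by
  have h : eta m * (toMat p)ᵀ * eta m * toMat p = 1 := by
    rw [mul_assoc (eta m), mul_assoc (eta m), toMat_mem, eta_mul_eta]
  have h2 := mul_eq_one_comm.1 h
  calc toMat p * eta m * (toMat p)ᵀ
      = toMat p * (eta m * (toMat p)ᵀ * eta m) * eta m := by
        simp only [mul_assoc, eta_mul_eta, mul_one]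
    _ = eta m := by rw [h2, one_mul]

/-! ### Behaviour of `𝒟⁰_N(λ)` under conjugation by the group -/

namespace IsLieRep

variable {V : Type*} [AddCommGroup V] [Module ℂ V] {m : ℕ} {ρ : LieG m → Module.End ℂ V}

theorem lowering_sum_smul (hρ : IsLieRep ρ) {ι : Type*} (s : Finset ι) (c : ι → ℝ)
    (w : ι → Fin (m + 1) → ℝ) : ρ (lowering m (∑ i ∈ s, c i • w i))
      = ∑ i ∈ s, (c i : ℂ) • ρ (lowering m (w i)) := by
  let f : LieG m →+ Module.End ℂ V := AddMonoidHom.mk' ρ hρ.map_add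
  have hf : ∀ Y, ρ Y = f Y := fun _ => rfl
  rw [_root_.map_sum, hf, _root_.map_sum]
  refine Finset.sum_congr rfl fun i _ => ?_
  rw [_root_.map_smul, ← hf, hρ.map_smul]

/-- The quadratic element of all coordinates is invariant under the group. -/
theorem sum_lowering_mulVec (hρ : IsLieRep ρ) {p : Mat m} (hp : p * eta m * pᵀ = eta m) :
    ∑ a : Fin (m + 1), (sgn a : ℂ) •
        (ρ (lowering m (p *ᵥ stdVec m a)) * ρ (lowering m (p *ᵥ stdVec m a)))
      = ∑ a : Fin (m + 1), (sgn a : ℂ) • (lower ρ a * lower ρ a) := by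
  have hcol : ∀ a : Fin (m + 1), p *ᵥ stdVec m a = ∑ b : Fin (m + 1), p b a • stdVec m b := by
    intro a
    have h1 : p *ᵥ stdVec m a = fun b => p b a := by
      ext b
      rw [Matrix.mulVec, dotProduct_comm, stdVec_dotProduct (Nat.le_of_lt_succ a.2)]
    rw [h1, pi_eq_sum_univ' fun b => p b a]
    exact Finset.sum_congr rfl fun b _ => by rw [stdVec_val]
  have hlow : ∀ a : Fin (m + 1), ρ (lowering m (p *ᵥ stdVec m a))
      = ∑ b : Fin (m + 1), (p b a : ℂ) • lower ρ b := fun a => by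
    rw [hcol, hρ.lowering_sum_smul]
    rfl
  -- This is the entry `(b, c)` of `p η pᵗ = η`: expanding the columns of `p` sums over the column
  -- index, hence this order of the factors in the hypothesis.
  have hentry : ∀ b c : Fin (m + 1), ∑ a : Fin (m + 1), (sgn a : ℂ) * ((p b a : ℂ) * (p c a : ℂ))
      = if b = c then (sgn b : ℂ) else 0 := by
    intro b c
    have h1 := congrFun (congrFun hp b) c
    rw [Matrix.mul_apply, eta, Matrix.diagonal_apply] at h1
    simp only [Matrix.mul_diagonal, Matrix.transpose_apply] at h1
    have h2 : ((∑ a : Fin (m + 1), p b a * sgn a * p c a : ℝ) : ℂ)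
        = if b = c then (sgn b : ℂ) else 0 :=
      (congrArg Complex.ofReal h1).trans (by
        rw [apply_ite Complex.ofReal, Complex.ofReal_zero]
        rfl)
    push_cast at h2
    rw [← h2]
    exact Finset.sum_congr rfl fun a _ => by ring
  calc _ = ∑ a : Fin (m + 1), ∑ b : Fin (m + 1), ∑ c : Fin (m + 1),
        ((sgn a : ℂ) * ((p b a : ℂ) * (p c a : ℂ))) • (lower ρ b * lower ρ c) := by
        refine Finset.sum_congr rfl fun a _ => ?_
        rw [hlow, Finset.sum_mul_sum, Finset.smul_sum]
        refine Finset.sum_congr rfl fun b _ => ?_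
        rw [Finset.smul_sum]
        refine Finset.sum_congr rfl fun c _ => ?_
        rw [smul_mul_smul_comm, smul_smul]
    _ = ∑ b : Fin (m + 1), ∑ c : Fin (m + 1), (if b = c then (sgn b : ℂ) else 0) •
        (lower ρ b * lower ρ c) := by
        rw [Finset.sum_comm]
        refine Finset.sum_congr rfl fun b _ => ?_
        rw [Finset.sum_comm]
        refine Finset.sum_congr rfl fun c _ => ?_
        rw [← Finset.sum_smul, hentry]
    _ = _ := by
        refine Finset.sum_congr rfl fun b _ => ?_
        simp only [ite_smul, zero_smul, Finset.sum_ite_eq, Finset.mem_univ, if_true]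

/-- Invariance is available for the sum over all coordinates; `Δ` is recovered by removing the
indices `0`, `3` and `n + 1`, whose summands are fixed individually. -/
theorem sum_range_eq {M : Type*} [AddCommGroup M] {n : ℕ} (hn : 3 ≤ n) (f : ℕ → M) :
    ∑ a ∈ transverseIndices n, f a = (∑ a : Fin (n + 2), f a) - f 0 - f 3 - f (n + 1) := by
  have h : Finset.range (n + 2) = insert 0 (insert 3 (insert (n + 1) (transverseIndices n))) := by
    ext a
    simp only [Finset.mem_range, Finset.mem_insert, mem_transverseIndices]
    omega
  rw [← Finset.sum_range, h, Finset.sum_insert, Finset.sum_insert, Finset.sum_insert]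
  · abel
  · simp [mem_transverseIndices]
  · simp [mem_transverseIndices]
    omega
  · simp [mem_transverseIndices]

/-- An operator which intertwines the action of `𝔫^-` with its image under a form preserving
matrix maps `𝒟⁰_N(λ)` to a multiple. -/
theorem conj_sum (hρ : IsLieRep ρ) {n : ℕ} (hn : n + 1 = m) (hn3 : 3 ≤ n) {p : Mat m}
    (hp : p * eta m * pᵀ = eta m) {ε : ℝ} (hε : ε * ε = 1)
    (h0 : p *ᵥ stdVec m 0 = ε • stdVec m 0) (h3 : p *ᵥ stdVec m 3 = ε • stdVec m 3)
    (hlast : p *ᵥ stdVec m m = stdVec m m) {P : Module.End ℂ V}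
    (hP : ∀ w, P * ρ (lowering m w) = ρ (lowering m (ε • (p *ᵥ w))) * P) (N : ℕ) (c : ℕ → ℂ)
    (u : V) :
    P ((∑ j ∈ Finset.range (N / 2 + 1), c j • (quad ρ ^ j * lower ρ m ^ (N - 2 * j))) u)
      = (ε : ℂ) ^ N •
        (∑ j ∈ Finset.range (N / 2 + 1), c j • (quad ρ ^ j * lower ρ m ^ (N - 2 * j))) (P u) := by
  have hεc : (ε : ℂ) * ε = 1 := by rw [← Complex.ofReal_mul, hε, Complex.ofReal_one]
  have hsm : ∀ w, ρ (lowering m (ε • w)) = (ε : ℂ) • ρ (lowering m w) := fun w => by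
    rw [_root_.map_smul, hρ.map_smul]
  have hT : P * lower ρ m = ((ε : ℂ) • lower ρ m) * P := by
    rw [lower, hP, hlast, hsm]
  have hsq : ∀ w, P * (ρ (lowering m w) * ρ (lowering m w))
      = ρ (lowering m (p *ᵥ w)) * ρ (lowering m (p *ᵥ w)) * P := fun w => by
    rw [← mul_assoc, hP, mul_assoc, hP, ← mul_assoc, hsm, smul_mul_smul_comm, hεc, one_smul]
  -- The sign `ε` disappears in squares. The full quadratic sum is invariant, and so are the three
  -- removed summands, since `p` scales each of these basis vectors by `ε` or fixes it.
  have hquad : Commute P (quad ρ) := by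
    have hfix : ∀ a : ℕ, (p *ᵥ stdVec m a = ε • stdVec m a ∨ p *ᵥ stdVec m a = stdVec m a) →
        ρ (lowering m (p *ᵥ stdVec m a)) * ρ (lowering m (p *ᵥ stdVec m a))
          = lower ρ a * lower ρ a := by
      rintro a (h | h)
      · rw [h, hsm, smul_mul_smul_comm, hεc, one_smul, lower]
      · rw [h, lower]
    have h := hρ.sum_lowering_mulVec hp
    subst hn
    rw [commute_iff_eq, quad, Nat.add_sub_cancel, Finset.mul_sum]
    have h1 : ∀ a ∈ transverseIndices n, P * ((sgn a : ℂ) • (lower ρ a * lower ρ a))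
        = (sgn a : ℂ) • (ρ (lowering (n + 1) (p *ᵥ stdVec (n + 1) a))
          * ρ (lowering (n + 1) (p *ᵥ stdVec (n + 1) a))) * P := fun a _ => by
      rw [mul_smul_comm, lower, hsq, smul_mul_assoc]
    rw [Finset.sum_congr rfl h1, ← Finset.sum_mul, sum_range_eq hn3, sum_range_eq hn3, h,
      hfix 0 (Or.inl h0), hfix 3 (Or.inl h3), hfix (n + 1) (Or.inr hlast)]
  have hpow : ∀ k : ℕ, P * lower ρ m ^ k = ((ε : ℂ) ^ k • lower ρ m ^ k) * P := fun k => by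
    have h : SemiconjBy P (lower ρ m) ((ε : ℂ) • lower ρ m) := hT
    have h2 := (h.pow_right k).eq
    rwa [smul_pow] at h2
  -- Only the factors `T` produce `ε`, and `N - 2j` has the parity of `N`; this makes all summands
  -- scale alike.
  have hpar : ∀ j ∈ Finset.range (N / 2 + 1), (ε : ℂ) ^ (N - 2 * j) = (ε : ℂ) ^ N := by
    intro j hj
    have hj' := Finset.mem_range.1 hj
    obtain ⟨k, rfl⟩ : ∃ k, N = k + 2 * j := ⟨N - 2 * j, by omega⟩
    rw [Nat.add_sub_cancel, pow_add, pow_mul, pow_two, hεc, one_pow, mul_one]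
  rw [← Module.End.mul_apply, ← Module.End.mul_apply, ← LinearMap.smul_apply]
  congr 1
  rw [Finset.mul_sum, Finset.sum_mul, Finset.smul_sum]
  refine Finset.sum_congr rfl fun j hj => ?_
  rw [mul_smul_comm, ← mul_assoc, (hquad.pow_right j).eq, mul_assoc, hpow, hpar j hj,
    smul_mul_assoc, mul_smul_comm, smul_mul_assoc, smul_comm, mul_assoc]

end IsLieRep

/-! ### From eigenvector equations to transformation laws and back -/

theorem hasDerivAt_expG_zero {m : ℕ} (u : Smooth m) (X : LieG m) (g : G m) :
    HasDerivAt (fun t : ℝ => u.1 (g * expG (t • X))) ((rightRep m X u).1 g) 0 := by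
  obtain ⟨F, hF, h⟩ := u.2 g
  have hc : Continuous fun t : ℝ => g * expG (t • X) :=
    continuous_const.mul (continuous_expG_smul X)
  have h0 : g * expG ((0 : ℝ) • X) = g := by rw [zero_smul, expG_zero, mul_one]
  have ht : Filter.Tendsto (fun t : ℝ => g * expG (t • X)) (𝓝 0) (𝓝 g) := by
    have := hc.tendsto 0
    rwa [h0] at this
  have h2 : HasFDerivAt F (fderiv ℝ F (entries g)) (toMat (g * expG ((0 : ℝ) • X))) := by
    rw [h0]
    exact (hF.differentiable (by simp) _).hasFDerivAt
  have h3 := (h2.comp_hasDerivAt 0 (hasDerivAt_curve g X)).congr_of_eventuallyEq (ht.eventually h)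
  rwa [← rightDeriv_eq hF h X] at h3

theorem hasDerivAt_expG {m : ℕ} (u : Smooth m) (X : LieG m) (g : G m) (t : ℝ) :
    HasDerivAt (fun t : ℝ => u.1 (g * expG (t • X)))
      ((rightRep m X u).1 (g * expG (t • X))) t := by
  have h := hasDerivAt_expG_zero u X (g * expG (t • X))
  have h2 : (fun s : ℝ => u.1 (g * expG (t • X) * expG (s • X)))
      = fun s : ℝ => (fun r : ℝ => u.1 (g * expG (r • X))) (t + s) := by
    funext s
    rw [mul_assoc, ← expG_add_smul]
  rw [h2] at h
  rw [← sub_self t] at h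
  have h3 := h.comp_sub_const t t
  simpa using h3

/-- Along the one-parameter group `u` solves `f' = c f`, so `e^{-ct} u(g exp(tX))` has derivative
zero and is constant. -/
theorem apply_mul_expG {m : ℕ} {u : Smooth m} {X : LieG m} {c : ℂ} (h : rightRep m X u = c • u)
    (g : G m) (t : ℝ) : u.1 (g * expG (t • X)) = Complex.exp (c * t) * u.1 g := by
  have hd : ∀ t : ℝ, HasDerivAt (fun t : ℝ => Complex.exp (-(c * t)) * u.1 (g * expG (t • X)))
      0 t := by
    intro t
    have h1 := hasDerivAt_expG u X g t
    rw [h] at h1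
    have h2 : HasDerivAt (fun t : ℝ => -(c * (t : ℂ))) (-(c * 1)) t :=
      (Complex.ofRealCLM.hasDerivAt.const_mul c).neg
    have h3 := h2.cexp.mul h1
    refine h3.congr_deriv ?_
    change _ + _ * (c * u.1 (g * expG (t • X))) = 0
    ring
  have hconst := is_const_of_deriv_eq_zero (fun t => (hd t).differentiableAt)
    (fun t => (hd t).deriv) t 0
  simp only [Complex.ofReal_zero, mul_zero, neg_zero, Complex.exp_zero, one_mul, zero_smul,
    expG_zero, mul_one] at hconst
  rw [← hconst, ← mul_assoc, ← Complex.exp_add, add_neg_cancel, Complex.exp_zero, one_mul]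

theorem rightRep_eq_smul {m : ℕ} {u : Smooth m} {X : LieG m} {c : ℂ}
    (h : ∀ (g : G m) (t : ℝ), u.1 (g * expG (t • X)) = Complex.exp (c * t) * u.1 g) :
    rightRep m X u = c • u := by
  refine Subtype.ext (funext fun g => ?_)
  have h1 := hasDerivAt_expG_zero u X g
  have h2 : HasDerivAt (fun t : ℝ => c * (t : ℂ)) (c * 1) 0 :=
    Complex.ofRealCLM.hasDerivAt.const_mul c
  have h3 := h2.cexp.mul_const (u.1 g)
  simp only [h g] at h1
  have h4 := h1.unique h3
  rw [h4]
  change _ = c * u.1 g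
  simp

theorem IsSmooth.rightTranslate {m : ℕ} {f : G m → ℂ} (hf : IsSmooth f) (p : G m) :
    IsSmooth fun x => f (x * p) := by
  intro g
  obtain ⟨F, hF, h⟩ := hf (g * p)
  refine ⟨fun A => F (mulRight (toMat p) A), hF.comp (mulRight (toMat p)).contDiff, ?_⟩
  exact (continuous_id.mul continuous_const).continuousAt.eventually h

/-- The action of `G^m` on `C^∞(G^m)` by right translation. -/
def rightTranslation {m : ℕ} (p : G m) : Module.End ℂ (Smooth m) where
  toFun u := ⟨fun x => u.1 (x * p), u.2.rightTranslate p⟩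
  map_add' _ _ := rfl
  map_smul' _ _ := rfl

/-- The hypothesis says `X' = Ad(p) X`, and it integrates to `p exp(tX) = exp(tX') p`. With
`mul_lowering` this supplies the intertwining hypothesis of `IsLieRep.conj_sum`. -/
theorem rightTranslation_mul_rightRep {m : ℕ} {p : G m} {X X' : LieG m}
    (h : toMat p * (X : Mat m) = (X' : Mat m) * toMat p) :
    rightTranslation p * rightRep m X = rightRep m X' * rightTranslation p := by
  refine LinearMap.ext fun u => Subtype.ext (funext fun x => ?_)
  change deriv (fun t : ℝ => u.1 (x * p * expG (t • X))) 0
    = deriv (fun t : ℝ => u.1 (x * expG (t • X') * p)) 0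
  congr 1
  funext t
  have h2 : p * expG (t • X) = expG (t • X') * p := semiconj_expG (by
    rw [SetLike.val_smul, SetLike.val_smul, mul_smul_comm, smul_mul_assoc, h])
  rw [mul_assoc, h2, mul_assoc]

theorem leftRep_mul_rightRep {m : ℕ} (g : G m) (X : LieG m) :
    leftRep m g * rightRep m X = rightRep m X * leftRep m g := by
  refine LinearMap.ext fun u => Subtype.ext (funext fun x => ?_)
  change deriv (fun t : ℝ => u.1 (g⁻¹ * x * expG (t • X))) 0
    = deriv (fun t : ℝ => u.1 (g⁻¹ * (x * expG (t • X)))) 0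
  simp only [mul_assoc]

/-- `R(𝒟⁰_N(λ))` commutes with left translations. -/
theorem R_D0_leftRep {n : ℕ} (hn : 3 ≤ n) (N : ℕ) (lam : ℂ) (g : G (n + 1))
    (u : Smooth (n + 1)) :
    R (n + 1) (D0 n N lam) (leftRep (n + 1) g u) = leftRep (n + 1) g (R (n + 1) (D0 n N lam) u) := by
  -- Left translation commutes with every `R(X)`, which is the case `p = 1`, `ε = 1` of the
  -- conjugation lemma.
  have h := (isLieRep_rightRep (n + 1)).conj_sum rfl hn (p := 1) (by simp) (ε := 1) (by simp)
    (by simp) (by simp) (by simp) (P := leftRep (n + 1) g)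
    (fun w => by
      rw [Matrix.one_mulVec, one_smul]
      exact leftRep_mul_rightRep g _) N (coeffD0 n N lam) u
  rw [← R_D0 hn, Complex.ofReal_one, one_pow] at h
  exact (h.trans (one_smul ℂ _)).symm

/-- Right translation by the image of `l` fixes `u`, so moving it past `𝒟⁰_N(λ)` leaves only the
factor `ε^N` with `ε = l₀₀`. -/
theorem R_D0_mul_incl {n : ℕ} (hn : 3 ≤ n) (N : ℕ) (lam : ℂ) {l : G n} (hl : l ∈ MGroup n)
    {u : Smooth (n + 1)} (hu : ∀ g, u.1 (g * incl n l) = u.1 g) (g : G (n + 1)) :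
    (R (n + 1) (D0 n N lam) u).1 (g * incl n l)
      = ((toMat l 0 0 : ℝ) : ℂ) ^ N * (R (n + 1) (D0 n N lam) u).1 g := by
  have hε := MGroup_sq hn hl
  have h0 := blockOne_mulVec_stdVec _ (Nat.zero_le n) (MGroup_mulVec_zero hn hl)
  have h3 := blockOne_mulVec_stdVec _ hn (MGroup_mulVec_three hn hl)
  have hq : toMat (incl n l) *ᵥ nullQ (n + 1) = toMat l 0 0 • nullQ (n + 1) := by
    rw [toMat_incl, nullQ, Matrix.mulVec_sub, h0, h3, smul_sub]
  -- Applying `lᵗ η l = η` to `q` gives `ε lᵗ p = p`, and `ε² = 1` moves the sign to the other side.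
  have hp : nullP (n + 1) ᵥ* toMat (incl n l) = toMat l 0 0 • nullP (n + 1) := by
    have h := congrArg (· *ᵥ nullQ (n + 1)) (toMat_mem (incl n l))
    simp only [← Matrix.mulVec_mulVec, hq, Matrix.mulVec_smul, eta_mulVec_nullQ, Matrix.mulVec_neg,
      Matrix.mulVec_transpose, smul_neg, neg_inj] at h
    have h' := congrArg (toMat l 0 0 • ·) h
    simp only [smul_smul, hε, one_smul] at h'
    exact h'
  have h := (isLieRep_rightRep (n + 1)).conj_sum rfl hn (mul_eta_mul_transpose (incl n l)) hε h0 h3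
    (blockOne_mulVec_last _) (P := rightTranslation (incl n l))
    (fun w => rightTranslation_mul_rightRep (mul_lowering _ hε hq hp w)) N (coeffD0 n N lam) u
  have hinv : rightTranslation (incl n l) u = u := Subtype.ext (funext hu)
  rw [← R_D0 hn, hinv] at h
  exact congrFun (congrArg Subtype.val h) g

/-! ### Induced spaces and the intertwining maps -/

section Ind

variable {m k : ℕ} {ι : G m →* G k} {L : Subgroup (G m)} {σ : L →* ℂ} {lam : ℂ} {u : Smooth k}

theorem Ind_apply_mul (hu : u ∈ Ind ι L σ lam) (g : G k) (l : L) :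
    u.1 (g * ι l) = σ l * u.1 g := by
  have h := hu g l 0 0 (zero_mem _)
  rwa [zero_smul, expG_zero, mul_one, mul_one, Complex.ofReal_zero, mul_zero, Complex.exp_zero,
    mul_one] at h

theorem Ind_apply_mul_exp_H (hu : u ∈ Ind ι L σ lam) (g : G k) (t : ℝ) :
    u.1 (g * ι (expG (t • H m))) = Complex.exp (lam * t) * u.1 g := by
  have h := hu g 1 t 0 (zero_mem _)
  rwa [expG_zero, mul_one, Subgroup.coe_one, one_mul, map_one, one_mul] at h

theorem Ind_apply_mul_exp_nPlus (hu : u ∈ Ind ι L σ lam) (g : G k) {X : LieG m}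
    (hX : X ∈ nPlus m) : u.1 (g * ι (expG X)) = u.1 g := by
  have h := hu g 1 0 X hX
  rwa [zero_smul, expG_zero, mul_one, Subgroup.coe_one, one_mul, map_one, Complex.ofReal_zero,
    mul_zero, Complex.exp_zero, one_mul, one_mul] at h

end Ind

/-- On the source side `M_0 ≤ L'` suffices for annihilation by `𝔪_{n+1}`, and `L ≤ L'` after
inclusion for invariance under `L`. With the value of `σ` left as a hypothesis, the statement covers
both `M` and `M̂`. -/
theorem R_D0_mem_Ind {n : ℕ} (hn : 4 ≤ n) (N : ℕ) (lam : ℂ) {L' : Subgroup (G (n + 1))}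
    (hM0 : M0 (n + 1) ≤ L') {L : Subgroup (G n)} (hL : L ≤ MGroup n)
    (hLL' : L ≤ L'.comap (incl n)) {σ : L →* ℂ}
    (hσ : ∀ l : L, σ l = ((toMat l.1 0 0 : ℝ) : ℂ) ^ N) {u : Smooth (n + 1)}
    (hu : u ∈ Ind (MonoidHom.id (G (n + 1))) L' 1 lam) :
    R (n + 1) (D0 n N lam) u ∈ Ind (incl n) L σ (lam - N) := by
  have hn3 : 3 ≤ n := by omega
  have huL : ∀ (g : G (n + 1)), ∀ l ∈ L', u.1 (g * l) = u.1 g := fun g l hl =>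
    (Ind_apply_mul hu g ⟨l, hl⟩).trans (one_mul _)
  have hH : rightRep (n + 1) (H (n + 1)) u = lam • u :=
    rightRep_eq_smul fun g t => Ind_apply_mul_exp_H hu g t
  have hp : ∀ X ∈ nPlus (n + 1), rightRep (n + 1) X u = 0 := fun X hX => by
    refine (rightRep_eq_smul (c := 0) fun g t => ?_).trans (zero_smul ℂ u)
    rw [zero_mul, Complex.exp_zero, one_mul]
    exact Ind_apply_mul_exp_nPlus hu g (Submodule.smul_mem _ t hX)
  have hm : ∀ Z ∈ mAlg (n + 1), rightRep (n + 1) Z u = 0 := fun Z hZ => by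
    refine (rightRep_eq_smul (c := 0) fun g t => ?_).trans (zero_smul ℂ u)
    rw [huL g _ (hM0 (Subgroup.subset_closure ⟨_, Submodule.smul_mem _ t hZ, rfl⟩)), zero_mul,
      Complex.exp_zero, one_mul]
  have hA : ∀ t : ℝ, incl n (expG (t • H n)) = expG (t • H (n + 1)) := fun t => by
    rw [incl_expG (by omega), map_smul, inclLie_H hn3]
  intro g l t X hX
  -- Elements from `𝔤_n` have zero last row, so the condition of `nPlus_sum` on the last coordinate
  -- holds. Annihilation is written as eigenvalue `0` to suit `apply_mul_expG`.
  have hXv : rightRep (n + 1) (inclLie (by omega) X) (R (n + 1) (D0 n N lam) u)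
      = (0 : ℂ) • R (n + 1) (D0 n N lam) u := by
    rw [R_D0 hn3]
    refine ((isLieRep_rightRep (n + 1)).nPlus_sum rfl hn3 hH hm hp N (inclLie_mem_nPlus hn3 hX)
      (blockZero_last_left _ _)).trans (zero_smul ℂ _).symm
  -- The factors of `g l a n'` are removed from the right: `n'` as the time-one point of its
  -- one-parameter group, then `a` through the weight `λ - N`, then `l` through the sign.
  have h1 := apply_mul_expG hXv (g * (incl n l * expG (t • H (n + 1)))) 1
  have h2 := apply_mul_expG (H_R_D0 hn3 hH N lam) (g * incl n l) t
  rw [one_smul, zero_mul, Complex.exp_zero, one_mul] at h1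
  rw [map_mul, map_mul, hA, incl_expG (by omega), ← mul_assoc, h1, ← mul_assoc, h2,
    R_D0_mul_incl hn3 N lam (hL l.2) (fun g => huL g _ (hLL' l.2)), hσ]
  ring

theorem iStar_mem_Ind {n : ℕ} {L : Subgroup (G n)} {σ : L →* ℂ} {lam : ℂ} {u : Smooth (n + 1)}
    (hu : u ∈ Ind (incl n) L σ lam) : iStar n u ∈ Ind (MonoidHom.id (G n)) L σ lam := by
  intro g l t X hX
  rw [iStar_apply, iStar_apply, map_mul]
  exact hu (incl n g) l t X hX

/-- The maps `D'_N(λ)` and `D_N(λ)` for subgroups of `M^{n+1}` and `M^n`. -/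
theorem exists_intertwiningMaps {n : ℕ} (hn : 4 ≤ n) (N : ℕ) {L' : Subgroup (G (n + 1))}
    (hM0 : M0 (n + 1) ≤ L') {L : Subgroup (G n)} (hL : L ≤ MGroup n)
    (hLL' : L ≤ L'.comap (incl n)) {σ : L →* ℂ}
    (hσ : ∀ l : L, σ l = ((toMat l.1 0 0 : ℝ) : ℂ) ^ N) :
    ∃ D' : ∀ lam : ℂ, Representation.IntertwiningMap
        (indRep (MonoidHom.id (G (n + 1))) L' 1 lam) (indRep (incl n) L σ (lam - N)),
      (∀ lam u, (D' lam u : Smooth (n + 1)) = R (n + 1) (D0 n N lam) (u : Smooth (n + 1))) ∧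
      ∃ D : ∀ lam : ℂ, Representation.IntertwiningMap
          ((indRep (MonoidHom.id (G (n + 1))) L' 1 lam).comp (incl n))
          (indRep (MonoidHom.id (G n)) L σ (lam - N)),
        ∀ lam u, (D lam u : Smooth n) = iStar n (D' lam u : Smooth (n + 1)) := by
  let D' : ∀ lam : ℂ, Representation.IntertwiningMap
      (indRep (MonoidHom.id (G (n + 1))) L' 1 lam) (indRep (incl n) L σ (lam - N)) := fun lam =>
    { toLinearMap := (R (n + 1) (D0 n N lam)).restrict
        fun _ hu => R_D0_mem_Ind hn N lam hM0 hL hLL' hσ hu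
      isIntertwining' := fun g => LinearMap.ext fun u => Subtype.ext
        (R_D0_leftRep (by omega) N lam g u.1) }
  refine ⟨D', fun _ _ => rfl, fun lam =>
    { toLinearMap := ((iStar n).restrict fun _ hu => iStar_mem_Ind hu) ∘ₗ (D' lam).toLinearMap
      isIntertwining' := fun g => LinearMap.ext fun u => Subtype.ext ?_ }, fun _ _ => rfl⟩
  change iStar n (R (n + 1) (D0 n N lam) (leftRep (n + 1) (incl n g) u.1))
    = leftRep n g (iStar n (R (n + 1) (D0 n N lam) u.1))
  rw [R_D0_leftRep (by omega)]
  refine Subtype.ext (funext fun x => ?_)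
  change (R (n + 1) (D0 n N lam) u.1).1 ((incl n g)⁻¹ * incl n x)
    = (R (n + 1) (D0 n N lam) u.1).1 (incl n (g⁻¹ * x))
  rw [map_mul, map_inv]

/-- The square of `l₀₀` is `1`, so its `N`-th power is trivial for even `N` and equals `σ_-` for odd
`N`. -/
theorem sigma_apply {m : ℕ} (hm : 3 ≤ m) (N : ℕ) (l : MGroup m) :
    sigma hm N l = ((toMat l.1 0 0 : ℝ) : ℂ) ^ N := by
  have h : ((toMat l.1 0 0 : ℝ) : ℂ) * ((toMat l.1 0 0 : ℝ) : ℂ) = 1 := by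
    rw [← Complex.ofReal_mul, MGroup_sq hm l.2, Complex.ofReal_one]
  rcases Nat.even_or_odd' N with ⟨k, rfl | rfl⟩
  · rw [sigma, if_pos (even_two_mul k), pow_mul, pow_two, h, one_pow]
    rfl
  · rw [sigma, if_neg (by simp), pow_succ, pow_mul, pow_two, h, one_pow, one_mul]
    rfl

theorem toMat_zero_zero_of_mem_MHat {m : ℕ} (hm : 3 ≤ m) {l : G m} (hl : l ∈ MHat m) :
    ((toMat l 0 0 : ℝ) : ℂ) = 1 :=
  sigmaMinus_of_mem_MHat hm ⟨l, MHat_le_MGroup m hl⟩ hl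

end AdSEin

end

theorem theorem1p2 (n : ℕ) (hn : 4 ≤ n) (N : ℕ) :
    (∃ D' : ∀ lam : ℂ, Representation.IntertwiningMap
        (indRep (MonoidHom.id (G (n + 1))) (MGroup (n + 1)) 1 lam)
        (indRep (incl n) (MGroup n) (sigma (le_of_lt hn) N) (lam - N)),
      (∀ lam u, (D' lam u : Smooth (n + 1)) = R (n + 1) (D0 n N lam) (u : Smooth (n + 1))) ∧
      ∃ D : ∀ lam : ℂ, Representation.IntertwiningMap
          ((indRep (MonoidHom.id (G (n + 1))) (MGroup (n + 1)) 1 lam).comp (incl n))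
          (indRep (MonoidHom.id (G n)) (MGroup n) (sigma (le_of_lt hn) N) (lam - N)),
        ∀ lam u, (D lam u : Smooth n) = iStar n (D' lam u : Smooth (n + 1))) ∧
    (∃ D' : ∀ lam : ℂ, Representation.IntertwiningMap
        (indRep (MonoidHom.id (G (n + 1))) (MHat (n + 1)) 1 lam)
        (indRep (incl n) (MHat n) 1 (lam - N)),
      (∀ lam u, (D' lam u : Smooth (n + 1)) = R (n + 1) (D0 n N lam) (u : Smooth (n + 1))) ∧
      ∃ D : ∀ lam : ℂ, Representation.IntertwiningMap
          ((indRep (MonoidHom.id (G (n + 1))) (MHat (n + 1)) 1 lam).comp (incl n))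
          (indRep (MonoidHom.id (G n)) (MHat n) 1 (lam - N)),
        ∀ lam u, (D lam u : Smooth n) = iStar n (D' lam u : Smooth (n + 1))) := by
  -- Both parts are instances of one construction, for the pairs `M^{n+1}, M^n` and `M̂^{n+1},
  -- M̂^n`; in the second the sign `l₀₀` is `1`, so the character is trivial for every `N`.
  refine ⟨exists_intertwiningMaps hn N le_sup_right le_rfl (MGroup_le_comap (le_of_lt hn))
      (sigma_apply (le_of_lt hn) N),
    exists_intertwiningMaps hn N le_sup_right (MHat_le_MGroup n) (MHat_le_comap (le_of_lt hn))
      fun l => ?_⟩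
  rw [toMat_zero_zero_of_mem_MHat (le_of_lt hn) l.2, one_pow]
  rfl
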